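/- Let $n\ge 1$ and let $k,l\ge 0$ be integers with $0<k+2l\le n$. Let $\xi_0,\dots,\xi_n$ be independent real-valued random variables with probability density functions $f_0,\dots,f_n$ (Borel measurable, nonnegative), and let $G(z)=\xi_0+\xi_1z+\dots+\xi_nz^n$. Let $\mu=\sum_{z\in\mathbb C:\,G(z)=0}\delta_z$ be the empirical measure of the zeros of $G$, and let $\mathbb C_+=\{z\in\mathbb C:\operatorname{Im}z>0\}$; for every Borel set $B\subset\mathbb C$, $\mu(B)$ is a random variable (measurable up to a null set). A Lebesgue measurable function $\rho_{k,l}:\mathbb R^k\times\mathbb C_+^l\to[0,\infty)$ is called a mixed $(k,l)$-correlation function of the zeros of $G$ if for all mutually disjoint Borel sets $B_1,\dots,B_k\subset\mathbb R$ and $B_{k+1},\dots,B_{k+l}\subset\mathbb C_+$ $$\mathbb E\Big[\prod_{i=1}^{k+l}\mu(B_i)\Big]=\int_{B_1}\cdots\int_{B_{k+l}}\rho_{k,l}(\mathbf x,\mathbf z)\,d\mathbf x\,d\mathbf z,$$ where $d\mathbf x\,d\mathbf z$ is Lebesgue measure (area measure on each copy of $\mathbb C_+$). For $1\le m\le n$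 let $\sigma_r(z_1,\dots,z_m)$ be the $r$-th elementary symmetric polynomial ($\sigma_0=1$, and $\sigma_r=0$ for $r<0$ or $r>m$), let $\mathrm v_m(z_1,\dots,z_m)=\prod_{1\le i<j\le m}|z_i-z_j|$, and for points $(z_1,\dots,z_m)\in\mathbb C^m$ all of whose elementary symmetric functions are real put $$\rho_m(z_1,\dots,z_m)=\mathrm v_m(z_1,\dots,z_m)\int_{\mathbb R^{n-m+1}}\prod_{i=0}^n f_i\Big(\sum_{j=0}^{n-m}(-1)^{m-i+j}\sigma_{m-i+j}(z_1,\dots,z_m)\,t_j\Big)\prod_{i=1}^m\Big|\sum_{j=0}^{n-m}t_jz_i^j\Big|\,dt_0\cdots dt_{n-m}$$ (with the value $0$ at the points where the integral diverges). Then all elementary symmetric functions of $(\mathbf x,\mathbf z,\bar{\mathbf z})$ are real, the integral defining $\rho_{k+2l}(\mathbf x,\mathbf z,\bar{\mathbf z})$ is finite for almost every $(\mathbf x,\mathbf z)\in\mathbb R^k\times\mathbb C_+^l$, and $$\rho_{k,l}(\mathbf x,\mathbf z)=2^l\,\rho_{k+2l}(\mathbf x,\mathbf z,\bar{\mathbf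 z}),$$ in the following sense: the right-hand side is a mixed $(k,l)$-correlation function of the zeros of $G$, and every mixed $(k,l)$-correlation function of the zeros of $G$ equals it at almost every point of $\mathbb R^k\times\mathbb C_+^l$. Specifically, for all $(\mathbf x,\mathbf z)\in\mathbb R^k\times\mathbb C_+^l$, $$2^l\rho_{k+2l}(\mathbf x,\mathbf z,\bar{\mathbf z})=2^l\,\mathrm v_{k+2l}(\mathbf x,\mathbf z,\bar{\mathbf z})\int_{\mathbb R^{n-k-2l+1}}\prod_{i=0}^n f_i\Big(\sum_{j=0}^{n-k-2l}(-1)^{k-i+j}t_j\,\sigma_{k+2l-i+j}(\mathbf x,\mathbf z,\bar{\mathbf z})\Big)\prod_{i=1}^k\Big|\sum_{j=0}^{n-k-2l}t_jx_i^j\Big|\prod_{i=1}^l\Big|\sum_{j=0}^{n-k-2l}t_jz_i^j\Big|^2\,dt_0\cdots dt_{n-k-2l}.$$ -/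

import Mathlib

open MeasureTheory ProbabilityTheory

noncomputable section

/-- The open upper half-plane, as a subset of the complex plane. -/
def upperC : Set ℂ := {z | 0 < z.im}

/-- The random polynomial `G(z) = ξ₀ + ξ₁ z + ⋯ + ξₙ zⁿ` for the outcome `ω`. -/
def randomPoly {Ω : Type*} {n : ℕ} (ξ : Fin (n + 1) → Ω → ℝ) (ω : Ω) (z : ℂ) : ℂ :=
  ∑ i : Fin (n + 1), (ξ i ω : ℂ) * z ^ (i : ℕ)

/-- The empirical measure of the zeros of `g`: the sum of the unit point masses at the
points `z` with `g z = 0`. -/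
def zeroMeasure (g : ℂ → ℂ) : Measure ℂ :=
  Measure.sum fun z : {z : ℂ // g z = 0} => Measure.dirac (z : ℂ)

/-- The configuration space `ℝᵏ × ℂ₊ˡ`, as a subset of `ℝᵏ × ℂˡ`. -/
def mixedDomain (k l : ℕ) : Set ((Fin k → ℝ) × (Fin l → ℂ)) :=
  {p | ∀ j, p.2 j ∈ upperC}

/-- `ρ` is a mixed `(k,l)`-correlation function of the zeros of the random polynomial with
coefficients `ξ`. Only the values of `ρ` on `ℝᵏ × ℂ₊ˡ` matter. Both sides of the defining
identity are integrals of nonnegative functions with values in `[0, ∞]`. -/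
structure IsMixedCorrelation {Ω : Type*} [MeasurableSpace Ω] (P : Measure Ω) {n : ℕ}
    (ξ : Fin (n + 1) → Ω → ℝ) (k l : ℕ) (ρ : (Fin k → ℝ) × (Fin l → ℂ) → ℝ) : Prop where
  aemeasurable : AEMeasurable ρ (volume.restrict (mixedDomain k l))
  nonneg : ∀ p ∈ mixedDomain k l, 0 ≤ ρ p
  expectation_eq : ∀ (A : Fin k → Set ℝ) (B : Fin l → Set ℂ),
    (∀ i, MeasurableSet (A i)) → (∀ j, MeasurableSet (B j)) → (∀ j, B j ⊆ upperC) →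
    Pairwise (fun i i' => Disjoint (A i) (A i')) →
    Pairwise (fun j j' => Disjoint (B j) (B j')) →
    ∫⁻ ω, (∏ i, zeroMeasure (randomPoly ξ ω) (Complex.ofReal '' A i)) *
        (∏ j, zeroMeasure (randomPoly ξ ω) (B j)) ∂P =
      ∫⁻ p in (Set.univ.pi A) ×ˢ (Set.univ.pi B), ENNReal.ofReal (ρ p)

/-- The elementary symmetric polynomial `σ_r(z₁, …, z_m)`, with an integer index `r`; it is
zero for `r < 0` and for `r > m` (where the sum is empty), and `1` for `r = 0`. -/
def elemSymm {m : ℕ} (r : ℤ) (z : Fin m → ℂ) : ℂ :=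
  if 0 ≤ r then ∑ s ∈ (Finset.univ : Finset (Fin m)).powersetCard r.toNat, ∏ j ∈ s, z j else 0

/-- The absolute value of the Vandermonde determinant, `∏_{i < j} |z_i - z_j|`. -/
def absVandermonde {m : ℕ} (z : Fin m → ℂ) : ℝ :=
  ∏ i, ∏ j ∈ Finset.Ioi i, ‖z i - z j‖

/-- The integrand, as a function of `t = (t₀, …, t_{n-m})`, in the definition of `ρ_m`. The
arguments of the `f i` are real parts; no information is lost at the points where all
elementary symmetric functions of `z` are real. -/
def rhoIntegrand (n : ℕ) (f : Fin (n + 1) → ℝ → ℝ) {m : ℕ} (z : Fin m → ℂ)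
    (t : Fin (n - m + 1) → ℝ) : ℝ :=
  (∏ i : Fin (n + 1), f i
      (∑ j : Fin (n - m + 1), (-1 : ℝ) ^ ((m : ℤ) - (i : ℕ) + (j : ℕ)) *
        (elemSymm ((m : ℤ) - (i : ℕ) + (j : ℕ)) z).re * t j)) *
    ∏ i : Fin m, ‖∑ j : Fin (n - m + 1), (t j : ℂ) * z i ^ (j : ℕ)‖

/-- The function `ρ_m(z₁, …, z_m)`. -/
def rho (n : ℕ) (f : Fin (n + 1) → ℝ → ℝ) {m : ℕ} (z : Fin m → ℂ) : ℝ :=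
  absVandermonde z * ∫ t : Fin (n - m + 1) → ℝ, rhoIntegrand n f z t

/-- The point `(x, z, z̄)` of `ℂ^{k+2l}`. -/
def withConj {k l : ℕ} (x : Fin k → ℝ) (z : Fin l → ℂ) : Fin (k + 2 * l) → ℂ :=
  fun i => Fin.append (fun i => (x i : ℂ))
    (Fin.append z (fun j => (starRingEnd ℂ) (z j))) (Fin.cast (by omega) i)

end

/-! Put `m = k + 2 * l`. A real polynomial of degree at most `n` that vanishes at distinct points
`x`, `z`, `z̄` is, in exactly one way, the monic real polynomial with these roots times a real
cofactor with `n - m + 1` coefficients `t`. Hence `(x, Re z, Im z, t) ↦ coefficients` maps a real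
space of dimension `n + 1` to one of the same dimension. Over disjoint sets `A i`, `B j`, a
coefficient vector `b ≠ 0` has as many preimages as there are tuples of zeros in these sets
(`encard_paramsOver_fiber`), and this number is the product of the zero counts.

The expected product of counts is therefore the integral of the joint density against a fibre
cardinality. The area formula (`lintegral_encard_fiber_mul`) turns it into an integral over the
parameters, weighted by the Jacobian. By `abs_det_fderiv_rootsToCoeffs` the Jacobian is the
Vandermonde product times the cofactor's absolute values at the roots, times `2 ^ l` from the change
`(Re z, Im z) ↦ (z, z̄)`. Integrating out `t` leaves `2 ^ l * rho`.

All this is done in `[0, ∞]` (`mixedDensity`). Convergence of the integral follows afterwards: a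
nonzero polynomial has at most `n` zeros, so the expectations are finite. Products of disjoint sets
from a countable basis cover almost every configuration (`ae_mixedDomain_of_forall_family`), which
makes finiteness and uniqueness global. -/

noncomputable section

/-! ### The area formula for differentiable self-maps. -/

section AreaFormula
open Set Function
open scoped ENNReal NNReal

variable {E : Type*} [NormedAddCommGroup E] [NormedSpace ℝ E] [FiniteDimensional ℝ E]
  [MeasurableSpace E] [BorelSpace E] {f : E → E} {f' : E → E →L[ℝ] E}

/-- A differentiable self-map is injective on each piece of a suitable countable measurable
partition of the set where its derivative is invertible. -/
theorem exists_partition_injOn_of_det_ne_zero (hf : ∀ x, HasFDerivAt f (f' x) x) (s : Set E)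
    (hs : ∀ x ∈ s, (f' x).det ≠ 0) :
    ∃ t : ℕ → Set E, Pairwise (Disjoint on t) ∧ (∀ n, MeasurableSet (t n)) ∧
      (s ⊆ ⋃ n, t n) ∧ ∀ n, InjOn f (s ∩ t n) := by
  -- A map close enough to an invertible linear map is injective. Singular `A` get the dummy radius
  -- `1`, because the partition lemma asks for a nonzero radius at every `A`.
  have h : ∀ A : E →L[ℝ] E, ∃ r : ℝ≥0, r ≠ 0 ∧ (A.det ≠ 0 →
      ∀ u : Set E, ApproximatesLinearOn f A u r → InjOn f u) := by
    intro A
    by_cases hA : A.det = 0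
    · exact ⟨1, one_ne_zero, fun h => absurd hA h⟩
    · let B := A.toContinuousLinearEquivOfDetNeZero hA
      have hB : (B : E →L[ℝ] E) = A := A.coe_toContinuousLinearEquivOfDetNeZero hA
      rcases subsingleton_or_nontrivial E with hE | hE
      · exact ⟨1, one_ne_zero, fun _ u _ => fun x _ y _ _ => Subsingleton.elim _ _⟩
      · have hpos : 0 < ‖(B.symm : E →L[ℝ] E)‖₊⁻¹ := by
          have := B.nnnorm_symm_pos
          positivity
        -- Injectivity needs a constant strictly below `‖B⁻¹‖⁻¹`; hence the half.
        refine ⟨‖(B.symm : E →L[ℝ] E)‖₊⁻¹ / 2, (half_pos hpos).ne', fun _ u hu => ?_⟩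
        rw [← hB] at hu
        exact hu.injOn (Or.inr (NNReal.half_lt_self hpos.ne'))
  choose r hr0 hr using h
  obtain ⟨t, A, hdisj, hmeas, hcov, happ, hA⟩ :=
    exists_partition_approximatesLinearOn_of_hasFDerivWithinAt f s f'
      (fun x _ => (hf x).hasFDerivWithinAt) r hr0
  refine ⟨t, hdisj, hmeas, hcov, fun n => ?_⟩
  rcases s.eq_empty_or_nonempty with rfl | hne
  · simp
  · obtain ⟨y, hy, hAy⟩ := hA hne n
    exact hr (A n) (hAy ▸ hs y hy) _ (happ n)

theorem Set.encard_inter_preimage_singleton_of_injOn {α β : Type*} {f : α → β} {s : Set α}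
    (hf : InjOn f s) (a : β) :
    (((s ∩ f ⁻¹' {a}).encard : ℕ∞) : ℝ≥0∞) = (f '' s).indicator 1 a := by
  classical
  by_cases ha : a ∈ f '' s
  · obtain ⟨x, hx, rfl⟩ := ha
    have : s ∩ f ⁻¹' {f x} = {x} := by
      ext y
      simp only [mem_inter_iff, mem_preimage, mem_singleton_iff]
      exact ⟨fun h => hf h.1 hx h.2, by rintro rfl; exact ⟨hx, rfl⟩⟩
    rw [this, indicator_of_mem (mem_image_of_mem f hx)]
    simp
  · have : s ∩ f ⁻¹' {a} = ∅ := by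
      ext y
      simp only [mem_inter_iff, mem_preimage, mem_singleton_iff, mem_empty_iff_false, iff_false]
      rintro ⟨h1, h2⟩
      exact ha ⟨y, h1, h2⟩
    rw [this, indicator_of_notMem ha]
    simp

/-- Critical values form a null set (Sard). Over any other `a` the whole fibre lies in the regular
part, where each injective piece contributes one point or none. -/
theorem exists_ae_encard_eq_tsum (μ : Measure E) [μ.IsAddHaarMeasure]
    (hf : ∀ x, HasFDerivAt f (f' x) x) (hdet : Measurable fun x => (f' x).det)
    {s : Set E} (hs : MeasurableSet s) :
    ∃ t : ℕ → Set E, Pairwise (Disjoint on t) ∧ (∀ n, MeasurableSet (t n)) ∧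
      (⋃ n, t n = s ∩ {x | (f' x).det ≠ 0}) ∧ (∀ n, InjOn f (t n)) ∧
      ∀ᵐ a ∂μ, (((s ∩ f ⁻¹' {a}).encard : ℕ∞) : ℝ≥0∞) = ∑' n, (f '' t n).indicator 1 a := by
  have hfm : Measurable f :=
    (continuous_iff_continuousAt.2 fun x => (hf x).continuousAt).measurable
  have hreg : MeasurableSet {x | (f' x).det ≠ 0} := (hdet (measurableSet_singleton 0)).compl
  obtain ⟨t, hdisj, hmeas, hcov, hinj⟩ := exists_partition_injOn_of_det_ne_zero hf
    (s ∩ {x | (f' x).det ≠ 0}) (fun x hx => hx.2)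
  have hdisj' : Pairwise (Disjoint on fun n => (s ∩ {x | (f' x).det ≠ 0}) ∩ t n) :=
    fun i j hij => (hdisj hij).mono inter_subset_right inter_subset_right
  refine ⟨fun n => (s ∩ {x | (f' x).det ≠ 0}) ∩ t n, hdisj',
    fun n => (hs.inter hreg).inter (hmeas n), ?_, hinj, ?_⟩
  · rw [← inter_iUnion, inter_eq_left.2 hcov]
  · have hnull : μ (f '' (s ∩ {x | (f' x).det = 0})) = 0 :=
      addHaar_image_eq_zero_of_det_fderivWithin_eq_zero μ
        (fun x _ => (hf x).hasFDerivWithinAt) (fun x hx => hx.2)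
    have hae : ∀ᵐ a ∂μ, a ∉ f '' (s ∩ {x | (f' x).det = 0}) := measure_eq_zero_iff_ae_notMem.1 hnull
    filter_upwards [hae] with a ha
    have hpre : MeasurableSet (f ⁻¹' {a}) := hfm (measurableSet_singleton a)
    have heq : s ∩ f ⁻¹' {a} = ⋃ n, ((s ∩ {x | (f' x).det ≠ 0}) ∩ t n) ∩ f ⁻¹' {a} := by
      rw [← iUnion_inter, ← inter_iUnion, inter_eq_left.2 hcov]
      ext x
      simp only [mem_inter_iff, mem_ofPred_eq]
      refine ⟨fun h => ⟨⟨h.1, fun h0 => ha ⟨x, ⟨h.1, h0⟩, h.2⟩⟩, h.2⟩, fun h => ⟨h.1.1, h.2⟩⟩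
    -- Additivity of cardinality over the pieces is countable additivity of the counting measure.
    rw [← Measure.count_apply (hs.inter hpre), heq, measure_iUnion]
    · refine tsum_congr fun n => ?_
      rw [Measure.count_apply (((hs.inter hreg).inter (hmeas n)).inter hpre)]
      exact Set.encard_inter_preimage_singleton_of_injOn (hinj n) a
    · exact fun i j hij => (hdisj' hij).mono inter_subset_left inter_subset_left
    · exact fun n => ((hs.inter hreg).inter (hmeas n)).inter hpre

/-- The number of preimages of a point under a differentiable map is an almost everywhere
measurable function of the point. -/
theorem aemeasurable_encard_fiber (μ : Measure E) [μ.IsAddHaarMeasure]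
    (hf : ∀ x, HasFDerivAt f (f' x) x) (hdet : Measurable fun x => (f' x).det)
    {s : Set E} (hs : MeasurableSet s) :
    AEMeasurable (fun a => (((s ∩ f ⁻¹' {a}).encard : ℕ∞) : ℝ≥0∞)) μ := by
  obtain ⟨t, -, hmeas, -, hinj, hae⟩ := exists_ae_encard_eq_tsum μ hf hdet hs
  refine ⟨fun a => ∑' n, (f '' t n).indicator 1 a, ?_, hae⟩
  refine Measurable.tsum fun n => measurable_one.indicator ?_
  exact measurable_image_of_fderivWithin (hmeas n) (fun x _ => (hf x).hasFDerivWithinAt) (hinj n)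

/-- The area formula for a differentiable self-map of a finite-dimensional real vector space. -/
theorem lintegral_encard_fiber_mul (μ : Measure E) [μ.IsAddHaarMeasure]
    (hf : ∀ x, HasFDerivAt f (f' x) x) (hdet : Measurable fun x => (f' x).det)
    {s : Set E} (hs : MeasurableSet s) {g : E → ℝ≥0∞} (hg : Measurable g) :
    ∫⁻ a, (((s ∩ f ⁻¹' {a}).encard : ℕ∞) : ℝ≥0∞) * g a ∂μ =
      ∫⁻ x in s, ENNReal.ofReal |(f' x).det| * g (f x) ∂μ := by
  have hreg : MeasurableSet {x | (f' x).det ≠ 0} := (hdet (measurableSet_singleton 0)).compl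
  obtain ⟨t, hdisj, hmeas, hunion, hinj, hae⟩ := exists_ae_encard_eq_tsum μ hf hdet hs
  have him : ∀ n, MeasurableSet (f '' t n) := fun n =>
    measurable_image_of_fderivWithin (hmeas n) (fun x _ => (hf x).hasFDerivWithinAt) (hinj n)
  have h1 : ∫⁻ a, (((s ∩ f ⁻¹' {a}).encard : ℕ∞) : ℝ≥0∞) * g a ∂μ =
      ∑' n, ∫⁻ a in f '' t n, g a ∂μ := by
    rw [lintegral_congr_ae (hae.mono fun a ha => by rw [ha, ← ENNReal.tsum_mul_right]),
      lintegral_tsum (f := fun n a => (f '' t n).indicator 1 a * g a)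
        fun n => ((measurable_one.indicator (him n)).mul hg).aemeasurable]
    refine tsum_congr fun n => ?_
    rw [← lintegral_indicator (him n)]
    refine lintegral_congr fun a => ?_
    by_cases ha : a ∈ f '' t n
    · simp only [indicator_of_mem ha, Pi.one_apply, one_mul]
    · simp only [indicator_of_notMem ha, zero_mul]
  -- Critical points carry weight zero on the parameter side, so both sides reduce to the injective
  -- pieces.
  have h2 : ∫⁻ x in s, ENNReal.ofReal |(f' x).det| * g (f x) ∂μ =
      ∫⁻ x in s ∩ {x | (f' x).det ≠ 0}, ENNReal.ofReal |(f' x).det| * g (f x) ∂μ := by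
    rw [← lintegral_indicator hs, ← lintegral_indicator (hs.inter hreg)]
    refine lintegral_congr fun x => ?_
    by_cases hx : x ∈ s
    · by_cases hd : (f' x).det = 0
      · simp [indicator, hx, hd]
      · simp [indicator, hx, hd]
    · simp [indicator, hx]
  rw [h1, h2, ← hunion, lintegral_iUnion hmeas hdisj]
  exact tsum_congr fun n => lintegral_image_eq_lintegral_abs_det_fderiv_mul μ (hmeas n)
    (fun x _ => (hf x).hasFDerivWithinAt) (hinj n) g

end AreaFormula

/-! ### Vieta's formulas and the coefficients of a product. -/

section Coefficients
open Polynomial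

/-- The coefficients of the product of `∏ (X - w i)` and `∑ t j X ^ j`, when the elementary
symmetric functions of `w` are real. -/
def productCoeff (n : ℕ) {m : ℕ} (w : Fin m → ℂ) (t : Fin (n - m + 1) → ℝ) (i : Fin (n + 1)) : ℝ :=
  ∑ j : Fin (n - m + 1), (-1 : ℝ) ^ ((m : ℤ) - (i : ℕ) + (j : ℕ)) *
    (elemSymm ((m : ℤ) - (i : ℕ) + (j : ℕ)) w).re * t j

theorem elemSymm_eq_zero_of_lt {m : ℕ} {r : ℤ} (hr : (m : ℤ) < r) (w : Fin m → ℂ) :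
    elemSymm r w = 0 := by
  unfold elemSymm
  split_ifs
  · rw [Finset.powersetCard_eq_empty.2 (by simp; omega), Finset.sum_empty]
  · rfl

theorem elemSymm_eq_zero_of_neg {m : ℕ} {r : ℤ} (hr : r < 0) (w : Fin m → ℂ) :
    elemSymm r w = 0 := by
  unfold elemSymm
  rw [if_neg (by omega)]

@[simp]
theorem elemSymm_zero {m : ℕ} (w : Fin m → ℂ) : elemSymm 0 w = 1 := by
  simp [elemSymm]

theorem coeff_prod_X_sub_C {m : ℕ} (w : Fin m → ℂ) (d : ℕ) :
    (∏ i, (X - C (w i))).coeff d = (-1) ^ ((m : ℤ) - d) * elemSymm ((m : ℤ) - d) w := by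
  rcases le_or_gt d m with h | h
  · have h1 : ∀ i, X - C (w i) = X + C (-w i) := fun i => by rw [C_neg, sub_eq_add_neg]
    obtain ⟨e, rfl⟩ := Nat.exists_eq_add_of_le h
    simp_rw [h1]
    rw [Finset.prod_X_add_C_coeff _ _ (by simp)]
    have h2 : ((d + e : ℕ) : ℤ) - d = e := by push_cast; ring
    rw [h2, elemSymm, if_pos (by positivity), zpow_natCast, Finset.mul_sum]
    simp only [Finset.card_univ, Fintype.card_fin, Int.toNat_natCast, add_tsub_cancel_left]
    refine Finset.sum_congr rfl fun s hs => ?_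
    rw [Finset.prod_neg, (Finset.mem_powersetCard.1 hs).2]
  · rw [elemSymm_eq_zero_of_neg (by omega), mul_zero]
    refine coeff_eq_zero_of_natDegree_lt ?_
    rw [natDegree_finsetProd_X_sub_C_eq_card]
    simp [h]

/-- Reality of the symmetric functions of `w` enters as the existence of a real `p` with these
roots; this lemma and the next are the real and imaginary parts of Vieta's formula. -/
theorem coeff_of_map_eq_prod_X_sub_C {m : ℕ} {w : Fin m → ℂ} {p : ℝ[X]}
    (hp : p.map Complex.ofRealHom = ∏ i, (X - C (w i))) (d : ℕ) :
    p.coeff d = (-1) ^ ((m : ℤ) - d) * (elemSymm ((m : ℤ) - d) w).re := by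
  have h := coeff_prod_X_sub_C w d
  rw [← hp, coeff_map, Complex.ofRealHom_eq_coe] at h
  have h1 : ((-1 : ℂ) ^ ((m : ℤ) - d)) = (((-1 : ℝ) ^ ((m : ℤ) - d) : ℝ) : ℂ) := by push_cast; rfl
  rw [h1] at h
  have := congrArg Complex.re h
  rwa [Complex.re_ofReal_mul, Complex.ofReal_re] at this

theorem elemSymm_im_eq_zero {m : ℕ} {w : Fin m → ℂ} {p : ℝ[X]}
    (hp : p.map Complex.ofRealHom = ∏ i, (X - C (w i))) (r : ℤ) : (elemSymm r w).im = 0 := by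
  by_cases hr : r ≤ m
  · obtain ⟨d, hd⟩ := Int.eq_ofNat_of_zero_le (sub_nonneg.2 hr)
    have h := coeff_prod_X_sub_C w d
    rw [← hp, coeff_map, Complex.ofRealHom_eq_coe, show (m : ℤ) - d = r by omega] at h
    have h1 : ((-1 : ℂ) ^ r) = (((-1 : ℝ) ^ r : ℝ) : ℂ) := by push_cast; rfl
    rw [h1] at h
    have := congrArg Complex.im h
    rw [Complex.im_ofReal_mul, Complex.ofReal_im] at this
    exact (mul_eq_zero.1 this.symm).resolve_left (zpow_ne_zero _ (by norm_num))
  · rw [elemSymm_eq_zero_of_lt (by omega), Complex.zero_im]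

/-- The arguments of the `f i` in `rhoIntegrand` are a convolution: coefficient `d` of the product
is the sum over `j` of `t j` times coefficient `d - j` of `p`, which Vieta expresses by `σ_{m-d+j}`.
-/
theorem ofFn_productCoeff {n m : ℕ} (hm : m ≤ n) {w : Fin m → ℂ} {p : ℝ[X]}
    (hp : p.map Complex.ofRealHom = ∏ i, (X - C (w i))) (t : Fin (n - m + 1) → ℝ) :
    ofFn (n + 1) (productCoeff n w t) = p * ofFn (n - m + 1) t := by
  have hdeg : p.natDegree = m := by
    rw [← natDegree_map Complex.ofRealHom, hp, natDegree_finsetProd_X_sub_C_eq_card]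
    simp
  ext d
  by_cases hd : d < n + 1
  · rw [ofFn_coeff_eq_val_of_lt _ hd, ofFn_eq_sum_monomial, Finset.mul_sum, finsetSum_coeff]
    refine Finset.sum_congr rfl fun j _ => ?_
    rcases le_or_gt (j : ℕ) d with hj | hj
    · obtain ⟨e, rfl⟩ := Nat.exists_eq_add_of_le' hj
      rw [coeff_mul_monomial, coeff_of_map_eq_prod_X_sub_C hp]
      have : (m : ℤ) - ((e + j : ℕ) : ℤ) + (j : ℕ) = m - e := by push_cast; ring
      simp only [this]
    -- For `j > d` the index `m - d + j` exceeds `m`, so the extra terms of `productCoeff` vanish.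
    · rw [elemSymm_eq_zero_of_lt (by simp; omega)]
      rw [← C_mul_X_pow_eq_monomial, ← mul_assoc, coeff_mul_X_pow', if_neg (by omega)]
      simp
  · rw [ofFn_coeff_eq_zero_of_ge _ (by omega)]
    symm
    refine coeff_eq_zero_of_natDegree_lt (natDegree_mul_le.trans_lt ?_)
    have := ofFn_natDegree_lt (by omega : 1 ≤ n - m + 1) t
    omega

theorem aeval_ofFn {N : ℕ} (a : Fin N → ℝ) (z : ℂ) :
    aeval z (ofFn N a) = ∑ i, (a i : ℂ) * z ^ (i : ℕ) := by
  rw [ofFn_eq_sum_monomial, map_sum]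
  simp [aeval_monomial]

theorem sum_productCoeff_mul_pow {n m : ℕ} (hm : m ≤ n) {w : Fin m → ℂ} {p : ℝ[X]}
    (hp : p.map Complex.ofRealHom = ∏ i, (X - C (w i))) (t : Fin (n - m + 1) → ℝ) (y : ℂ) :
    ∑ i, (productCoeff n w t i : ℂ) * y ^ (i : ℕ) =
      (∏ i, (y - w i)) * ∑ j, (t j : ℂ) * y ^ (j : ℕ) := by
  rw [← aeval_ofFn, ofFn_productCoeff hm hp, map_mul, aeval_ofFn]
  congr 1
  rw [aeval_def, ← eval_map, show algebraMap ℝ ℂ = Complex.ofRealHom from rfl, hp, eval_prod]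
  simp

end Coefficients

/-! ### The Jacobian of the map from roots and cofactor to coefficients. -/

section Jacobian
open Matrix

/-- The roots, as linear functions of the real parameters `u`. -/
def linearRoots {m : ℕ} (B : Matrix (Fin m) (Fin m) ℂ) (u : Fin m → ℝ) : Fin m → ℂ :=
  fun r => ∑ c, B r c * (u c : ℂ)

/-- The index equivalence that enumerates the roots first and the coefficients of the cofactor
after them. -/
def sumEquivFin {n m : ℕ} (hm : m ≤ n) : Fin m ⊕ Fin (n - m + 1) ≃ Fin (n + 1) :=
  finSumFinEquiv.trans (finCongr (by omega))

@[simp]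
theorem sumEquivFin_inl {n m : ℕ} (hm : m ≤ n) (i : Fin m) :
    (sumEquivFin hm (Sum.inl i) : ℕ) = i := by
  simp [sumEquivFin]

@[simp]
theorem sumEquivFin_inr {n m : ℕ} (hm : m ≤ n) (j : Fin (n - m + 1)) :
    (sumEquivFin hm (Sum.inr j) : ℕ) = m + j := by
  simp [sumEquivFin]

/-- The map from the parameters of the roots and the coefficients of the cofactor to the
coefficients of the polynomial. -/
def rootsToCoeffs {n m : ℕ} (hm : m ≤ n) (B : Matrix (Fin m) (Fin m) ℂ)
    (v : Fin m ⊕ Fin (n - m + 1) → ℝ) : Fin m ⊕ Fin (n - m + 1) → ℝ :=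
  fun c => productCoeff n (linearRoots B (v ∘ Sum.inl)) (v ∘ Sum.inr) (sumEquivFin hm c)

theorem differentiable_elemSymm_linearRoots {m : ℕ} {ι : Type*} [Fintype ι] (e : Fin m → ι) (r : ℤ)
    (B : Matrix (Fin m) (Fin m) ℂ) :
    Differentiable ℝ fun v : ι → ℝ => elemSymm r (linearRoots B (v ∘ e)) := by
  unfold elemSymm linearRoots
  have h0 : ∀ c, Differentiable ℝ fun v : ι → ℝ => ((v (e c) : ℝ) : ℂ) := fun c =>
    Complex.ofRealCLM.differentiable.comp (differentiable_apply (e c))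
  have h : ∀ j, Differentiable ℝ fun v : ι → ℝ => ∑ c, B j c * ((v ∘ e) c : ℂ) := fun j =>
    Differentiable.fun_sum fun c _ => (h0 c).const_mul _
  split_ifs
  · fun_prop
  · exact differentiable_const _

theorem differentiable_rootsToCoeffs {n m : ℕ} (hm : m ≤ n) (B : Matrix (Fin m) (Fin m) ℂ) :
    Differentiable ℝ (rootsToCoeffs hm B) := by
  rw [differentiable_pi]
  intro c
  unfold rootsToCoeffs productCoeff
  refine Differentiable.fun_sum fun j _ => Differentiable.mul (Differentiable.const_mul ?_ _) ?_
  · exact Complex.reCLM.differentiable.comp (differentiable_elemSymm_linearRoots Sum.inl _ B)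
  · exact differentiable_apply (Sum.inr j)

/-- All monic polynomials with roots `linearRoots B u` are real. -/
def HasRealProducts {m : ℕ} (B : Matrix (Fin m) (Fin m) ℂ) : Prop :=
  ∀ u, ∃ p : Polynomial ℝ, p.map Complex.ofRealHom =
    ∏ i, (Polynomial.X - Polynomial.C (linearRoots B u i))

section

variable {n m : ℕ} (hm : m ≤ n) (B : Matrix (Fin m) (Fin m) ℂ)
  (v : Fin m ⊕ Fin (n - m + 1) → ℝ)

theorem sum_rootsToCoeffs_mul_pow (hB : HasRealProducts B) (y : ℂ) :
    ∑ c, (rootsToCoeffs hm B v c : ℂ) * y ^ (sumEquivFin hm c : ℕ) =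
      (∏ i, (y - linearRoots B (v ∘ Sum.inl) i)) *
        ∑ j : Fin (n - m + 1), (v (Sum.inr j) : ℂ) * y ^ (j : ℕ) := by
  obtain ⟨p, hp⟩ := hB (v ∘ Sum.inl)
  rw [show ∑ j : Fin (n - m + 1), (v (Sum.inr j) : ℂ) * y ^ (j : ℕ) =
    ∑ j, ((v ∘ Sum.inr) j : ℂ) * y ^ (j : ℕ) from rfl, ← sum_productCoeff_mul_pow hm hp]
  exact (sumEquivFin hm).sum_comp fun i =>
    (productCoeff n (linearRoots B (v ∘ Sum.inl)) (v ∘ Sum.inr) i : ℂ) * y ^ (i : ℕ)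

/-- The partial derivative of the coefficients in a cofactor direction. -/
theorem fderiv_rootsToCoeffs_inr (j j' : Fin (n - m + 1)) :
    fderiv ℝ (rootsToCoeffs hm B) v (Pi.single (Sum.inr j') 1) (Sum.inr j) =
      (-1 : ℝ) ^ ((j' : ℤ) - j) *
        (elemSymm ((j' : ℤ) - j) (linearRoots B (v ∘ Sum.inl))).re := by
  have hD := (differentiable_rootsToCoeffs hm B v).hasFDerivAt.hasLineDerivAt
    (Pi.single (Sum.inr j') 1)
  have h1 := (hasDerivAt_pi.1 hD) (Sum.inr j)
  refine h1.unique ?_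
  unfold rootsToCoeffs productCoeff
  -- A cofactor direction leaves the roots fixed, and the coefficients are linear in the cofactor.
  have h2 : ∀ x : ℝ, (v + x • Pi.single (Sum.inr j') 1) ∘ Sum.inl = v ∘ Sum.inl := by
    intro x; ext i; simp
  simp only [h2]
  have h3 : ∀ a : Fin (n - m + 1), HasDerivAt
      (fun x : ℝ => ((v + x • Pi.single (Sum.inr j') 1) ∘ Sum.inr) a)
      (if a = j' then 1 else 0) 0 := by
    intro a
    have : (fun x : ℝ => ((v + x • Pi.single (Sum.inr j') 1) ∘ Sum.inr) a) =
        fun x => v (Sum.inr a) + x * (if a = j' then 1 else 0) := by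
      ext x; simp [Pi.single_apply]
    rw [this]
    simpa using ((hasDerivAt_id (0 : ℝ)).mul_const (if a = j' then (1 : ℝ) else 0)).const_add
      (v (Sum.inr a))
  have h4 := HasDerivAt.fun_sum (u := Finset.univ) fun a _ => (h3 a).const_mul
    ((-1 : ℝ) ^ ((m : ℤ) - (sumEquivFin hm (Sum.inr j) : ℕ) + (a : ℕ)) *
      (elemSymm ((m : ℤ) - (sumEquivFin hm (Sum.inr j) : ℕ) + (a : ℕ))
        (linearRoots B (v ∘ Sum.inl))).re)
  convert h4 using 1
  simp only [mul_ite, mul_one, mul_zero, Finset.sum_ite_eq', Finset.mem_univ, if_true]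
  have : (m : ℤ) - (sumEquivFin hm (Sum.inr j) : ℕ) + (j' : ℕ) = j' - j := by
    rw [sumEquivFin_inr]; push_cast; ring
  rw [this]

/-- The derivative of the value of the polynomial at one of its roots. -/
theorem sum_fderiv_rootsToCoeffs_mul_pow (hB : HasRealProducts B) (i : Fin m)
    (h : Fin m ⊕ Fin (n - m + 1) → ℝ) :
    ∑ c, (fderiv ℝ (rootsToCoeffs hm B) v h c : ℂ) *
        linearRoots B (v ∘ Sum.inl) i ^ (sumEquivFin hm c : ℕ) =
      -((∏ r ∈ {i}ᶜ, (linearRoots B (v ∘ Sum.inl) i - linearRoots B (v ∘ Sum.inl) r)) *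
        ∑ j : Fin (n - m + 1), (v (Sum.inr j) : ℂ) *
          linearRoots B (v ∘ Sum.inl) i ^ (j : ℕ)) * linearRoots B (h ∘ Sum.inl) i := by
  set y := linearRoots B (v ∘ Sum.inl) i with hy
  have hD := (differentiable_rootsToCoeffs hm B v).hasFDerivAt.hasLineDerivAt h
  have h1 : HasDerivAt (fun s : ℝ => ∑ c, (rootsToCoeffs hm B (v + s • h) c : ℂ) *
      y ^ (sumEquivFin hm c : ℕ))
      (∑ c, (fderiv ℝ (rootsToCoeffs hm B) v h c : ℂ) * y ^ (sumEquivFin hm c : ℕ)) 0 :=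
    HasDerivAt.fun_sum fun c _ => (((hasDerivAt_pi.1 hD) c).ofReal_comp).mul_const _
  refine h1.unique ?_
  have hlin : ∀ (s : ℝ) r, linearRoots B ((v + s • h) ∘ Sum.inl) r =
      linearRoots B (v ∘ Sum.inl) r + s * linearRoots B (h ∘ Sum.inl) r := by
    intro s r
    simp only [linearRoots, Finset.mul_sum, ← Finset.sum_add_distrib]
    refine Finset.sum_congr rfl fun c _ => ?_
    simp
    ring
  -- The evaluation point `y` stays fixed while the roots move. Factor `i` is then a multiple of
  -- `s`, so the product rule at `s = 0` needs only the value of the remaining factors, not their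
  -- derivative.
  have heq : (fun s : ℝ => ∑ c, (rootsToCoeffs hm B (v + s • h) c : ℂ) *
      y ^ (sumEquivFin hm c : ℕ)) = fun s : ℝ => -((s : ℂ) * linearRoots B (h ∘ Sum.inl) i) *
        ((∏ r ∈ {i}ᶜ, (y - linearRoots B ((v + s • h) ∘ Sum.inl) r)) *
          ∑ j : Fin (n - m + 1), ((v + s • h) (Sum.inr j) : ℂ) * y ^ (j : ℕ)) := by
    ext s
    rw [sum_rootsToCoeffs_mul_pow hm B _ hB, ← Finset.prod_mul_prod_compl {i},
      Finset.prod_singleton, hlin s i, ← hy]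
    ring
  rw [heq]
  have hid : HasDerivAt (fun s : ℝ => -((s : ℂ) * linearRoots B (h ∘ Sum.inl) i))
      (-(1 * linearRoots B (h ∘ Sum.inl) i)) 0 := by
    have := (hasDerivAt_id (0 : ℝ)).ofReal_comp.mul_const (linearRoots B (h ∘ Sum.inl) i)
    simpa using this.fun_neg
  have hdiff : DifferentiableAt ℝ (fun s : ℝ =>
      (∏ r ∈ {i}ᶜ, (y - linearRoots B ((v + s • h) ∘ Sum.inl) r)) *
          ∑ j : Fin (n - m + 1), ((v + s • h) (Sum.inr j) : ℂ) * y ^ (j : ℕ)) 0 := by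
    have hs : Differentiable ℝ fun s : ℝ => (s : ℂ) := Complex.ofRealCLM.differentiable
    simp only [hlin, Pi.add_apply, Pi.smul_apply, smul_eq_mul, Complex.ofReal_add,
      Complex.ofReal_mul]
    refine DifferentiableAt.mul ?_ ?_
    · exact DifferentiableAt.fun_finsetProd fun r _ =>
        ((((hs _).mul_const _).const_add _).const_sub _)
    · exact DifferentiableAt.fun_sum fun j _ => (((hs _).mul_const _).const_add _).mul_const _
  refine (hid.fun_mul hdiff.hasDerivAt).congr_deriv ?_
  simp
  ring

/-- Each unordered pair occurs twice among the ordered pairs of distinct indices. -/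
theorem norm_prod_prod_compl_sub (w : Fin m → ℂ) :
    ∏ i, ∏ j ∈ ({i}ᶜ : Finset (Fin m)), ‖w i - w j‖ = absVandermonde w ^ 2 := by
  rw [← Finset.prod_prod_Ioi_mul_eq_prod_prod_off_diag (fun j i => ‖w i - w j‖), absVandermonde,
    ← Finset.prod_pow]
  refine Finset.prod_congr rfl fun i _ => ?_
  rw [← Finset.prod_pow]
  refine Finset.prod_congr rfl fun j _ => ?_
  rw [norm_sub_rev (w j), sq]

theorem norm_det_vandermonde (w : Fin m → ℂ) : ‖(vandermonde w).det‖ = absVandermonde w := by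
  rw [det_vandermonde, norm_prod, absVandermonde]
  refine Finset.prod_congr rfl fun i _ => ?_
  rw [norm_prod]
  exact Finset.prod_congr rfl fun j _ => norm_sub_rev _ _

/-- The Jacobian determinant of the map from roots and cofactor to coefficients. -/
theorem abs_det_fderiv_rootsToCoeffs (hB : HasRealProducts B)
    (hv : absVandermonde (linearRoots B (v ∘ Sum.inl)) ≠ 0) :
    |(fderiv ℝ (rootsToCoeffs hm B) v).det| =
      ‖B.det‖ * absVandermonde (linearRoots B (v ∘ Sum.inl)) *
        ∏ i, ‖∑ j : Fin (n - m + 1), (v (Sum.inr j) : ℂ) *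
          linearRoots B (v ∘ Sum.inl) i ^ (j : ℕ)‖ := by
  set w := linearRoots B (v ∘ Sum.inl) with hw
  set D := fderiv ℝ (rootsToCoeffs hm B) v with hD
  let M : Matrix (Fin m ⊕ Fin (n - m + 1)) (Fin m ⊕ Fin (n - m + 1)) ℝ :=
    LinearMap.toMatrix' (D : (Fin m ⊕ Fin (n - m + 1) → ℝ) →ₗ[ℝ] _)
  have hM : ∀ c d, M c d = D (Pi.single d 1) c := fun c d => LinearMap.toMatrix'_apply _ _ _
  have hdet : D.det = M.det := (LinearMap.det_toMatrix' _).symm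
  let Mc := M.map Complex.ofRealHom
  have hMc : Mc.det = (M.det : ℂ) := (RingHom.map_det Complex.ofRealHom M).symm
  let U : Matrix (Fin m) (Fin (n - m + 1)) ℂ := fun i j => w i ^ (m + j : ℕ)
  -- The upper rows of `W` evaluate a polynomial at the roots; the lower rows keep its coefficients
  -- of degree at least `m`. Multiplication by `W` makes the Jacobian matrix block triangular,
  -- because the value at a root has zero derivative in the cofactor directions.
  let W : Matrix (Fin m ⊕ Fin (n - m + 1)) (Fin m ⊕ Fin (n - m + 1)) ℂ :=
    Matrix.fromBlocks (vandermonde w) U 0 1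
  let R : Fin m → ℂ := fun i => -((∏ r ∈ {i}ᶜ, (w i - w r)) *
    ∑ j : Fin (n - m + 1), (v (Sum.inr j) : ℂ) * w i ^ (j : ℕ))
  let T : Matrix (Fin (n - m + 1)) (Fin (n - m + 1)) ℂ :=
    fun j j' => (D (Pi.single (Sum.inr j') 1) (Sum.inr j) : ℂ)
  let S : Matrix (Fin (n - m + 1)) (Fin m) ℂ :=
    fun j i => (D (Pi.single (Sum.inl i) 1) (Sum.inr j) : ℂ)
  have hrow : ∀ i d, (W * Mc) (Sum.inl i) d =
      R i * linearRoots B ((Pi.single d 1 : Fin m ⊕ Fin (n - m + 1) → ℝ) ∘ Sum.inl) i := by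
    intro i d
    rw [← sum_fderiv_rootsToCoeffs_mul_pow hm B v hB i, Matrix.mul_apply]
    refine Finset.sum_congr rfl fun c _ => ?_
    rw [mul_comm]
    refine congrArg₂ (· * ·) ?_ ?_
    · simp [Mc, hM, ← hD]
    · rcases c with c | c
      · rw [sumEquivFin_inl]; rfl
      · rw [sumEquivFin_inr]; rfl
  have hprod : W * Mc = Matrix.fromBlocks (Matrix.diagonal R * B) 0 S T := by
    ext (i | j) (d | d)
    · rw [hrow, Matrix.fromBlocks_apply₁₁, Matrix.diagonal_mul]
      congr 1
      rw [linearRoots, Finset.sum_eq_single d]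
      · simp
      · intro b _ hb
        simp [hb]
      · simp
    · rw [hrow, Matrix.fromBlocks_apply₁₂]
      simp [linearRoots]
    · rw [Matrix.fromBlocks_apply₂₁, Matrix.mul_apply, Fintype.sum_sum_type]
      simp [W, Mc, hM, S, Matrix.one_apply]
    · rw [Matrix.fromBlocks_apply₂₂, Matrix.mul_apply, Fintype.sum_sum_type]
      simp [W, Mc, hM, T, Matrix.one_apply]
  -- The entries are `±σ_{j'-j}`: zero below the diagonal and `σ_0 = 1` on it.
  have hT : T.det = 1 := by
    rw [Matrix.det_of_isUpperTriangular]
    · refine Finset.prod_eq_one fun j _ => ?_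
      simp [T, hD, fderiv_rootsToCoeffs_inr]
    · intro j j' hjj'
      simp only [id_eq] at hjj'
      have : ((j' : ℕ) : ℤ) - (j : ℕ) < 0 := by
        have : (j' : ℕ) < j := hjj'
        omega
      simp [T, hD, fderiv_rootsToCoeffs_inr, elemSymm_eq_zero_of_neg this]
  have hkey := congrArg Matrix.det hprod
  rw [Matrix.det_mul, Matrix.det_fromBlocks_zero₁₂, Matrix.det_fromBlocks_zero₂₁, hT, hMc,
    Matrix.det_mul, Matrix.det_diagonal, Matrix.det_one, ← hdet] at hkey
  have hnorm := congrArg norm hkey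
  simp only [norm_mul, norm_det_vandermonde, norm_prod, R, norm_neg, Finset.prod_mul_distrib,
    norm_prod_prod_compl_sub, mul_one, Complex.norm_real, Real.norm_eq_abs] at hnorm
  -- With `V` the Vandermonde product, `W` contributes `V` on the left and the diagonal block `V ^
  -- 2` on the right; one `V` cancels.
  refine mul_left_cancel₀ hv ?_
  rw [hnorm]
  ring

end

end Jacobian

/-! ### Real coordinates for real roots and conjugate pairs. -/

section MixedCoordinates
open Matrix

variable {k l : ℕ}

/-- The index equivalence underlying `withConj`. -/
def mixedIndexEquiv (k l : ℕ) : Fin k ⊕ (Fin l ⊕ Fin l) ≃ Fin (k + 2 * l) :=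
  ((Equiv.sumCongr (Equiv.refl _) finSumFinEquiv).trans finSumFinEquiv).trans
    (finCongr (by omega))

theorem withConj_mixedIndexEquiv (x : Fin k → ℝ) (z : Fin l → ℂ) (i : Fin k ⊕ (Fin l ⊕ Fin l)) :
    withConj x z (mixedIndexEquiv k l i) =
      Sum.elim (fun i => (x i : ℂ)) (Sum.elim z fun j => (starRingEnd ℂ) (z j)) i := by
  rcases i with i | i | i
  · simp [withConj, mixedIndexEquiv]
  · simp [withConj, mixedIndexEquiv]
  · simpa [withConj, mixedIndexEquiv] using
      Fin.append_right z (fun j => (starRingEnd ℂ) (z j)) i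

theorem prod_withConj {M : Type*} [CommMonoid M] (x : Fin k → ℝ) (z : Fin l → ℂ) (g : ℂ → M) :
    ∏ i, g (withConj x z i) =
      (∏ i, g (x i)) * ((∏ j, g (z j)) * ∏ j, g ((starRingEnd ℂ) (z j))) := by
  rw [← (mixedIndexEquiv k l).prod_comp]
  simp only [withConj_mixedIndexEquiv, Fintype.prod_sum_type, Sum.elim_inl, Sum.elim_inr]

/-- The real monic polynomial with the roots `x`, `z` and `z̄`. -/
def mixedPoly (x : Fin k → ℝ) (z : Fin l → ℂ) : Polynomial ℝ :=
  (∏ i, (Polynomial.X - Polynomial.C (x i))) *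
    ∏ j, (Polynomial.X ^ 2 - Polynomial.C (2 * (z j).re) * Polynomial.X +
      Polynomial.C (Complex.normSq (z j)))

theorem map_mixedPoly (x : Fin k → ℝ) (z : Fin l → ℂ) :
    (mixedPoly x z).map Complex.ofRealHom =
      ∏ i, (Polynomial.X - Polynomial.C (withConj x z i)) := by
  rw [prod_withConj x z fun w => Polynomial.X - Polynomial.C w, mixedPoly, Polynomial.map_mul,
    Polynomial.map_prod, Polynomial.map_prod, ← Finset.prod_mul_distrib]
  congr 1
  · simp
  · refine Finset.prod_congr rfl fun j _ => ?_
    have h1 : ((2 * (z j).re : ℝ) : ℂ) = z j + (starRingEnd ℂ) (z j) := by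
      rw [Complex.add_conj]
    simp only [Polynomial.map_add, Polynomial.map_sub, Polynomial.map_pow, Polynomial.map_X,
      Polynomial.map_mul, Polynomial.map_C, Complex.ofRealHom_eq_coe, h1, Complex.normSq_eq_conj_mul_self]
    simp only [Polynomial.C_add, Polynomial.C_mul]
    ring

theorem mixedPoly_ne_zero (x : Fin k → ℝ) (z : Fin l → ℂ) : mixedPoly x z ≠ 0 := by
  intro h
  have h1 := map_mixedPoly x z
  rw [h, Polynomial.map_zero] at h1
  exact (Polynomial.monic_prod_of_monic _ _ fun i _ =>
    Polynomial.monic_X_sub_C (withConj x z i)).ne_zero h1.symm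

theorem natDegree_mixedPoly (x : Fin k → ℝ) (z : Fin l → ℂ) :
    (mixedPoly x z).natDegree = k + 2 * l := by
  rw [← Polynomial.natDegree_map Complex.ofRealHom, map_mixedPoly,
    Polynomial.natDegree_finsetProd_X_sub_C_eq_card]
  simp

/-- The real and complex points with real parameters `u`. -/
def mixedPoint (u : Fin (k + 2 * l) → ℝ) : (Fin k → ℝ) × (Fin l → ℂ) :=
  (fun i => u (mixedIndexEquiv k l (Sum.inl i)),
    fun j => ⟨u (mixedIndexEquiv k l (Sum.inr (Sum.inl j))),
      u (mixedIndexEquiv k l (Sum.inr (Sum.inr j)))⟩)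

/-- The matrix of `(x, Re z, Im z) ↦ (x, z, z̄)`. -/
def mixedMatrix (k l : ℕ) : Matrix (Fin (k + 2 * l)) (Fin (k + 2 * l)) ℂ :=
  Matrix.reindex (mixedIndexEquiv k l) (mixedIndexEquiv k l)
    (Matrix.fromBlocks 1 0 0 (Matrix.fromBlocks 1 (Complex.I • 1) 1 (-Complex.I • 1)))

theorem linearRoots_mixedMatrix (u : Fin (k + 2 * l) → ℝ) :
    linearRoots (mixedMatrix k l) u = withConj (mixedPoint u).1 (mixedPoint u).2 := by
  ext r
  obtain ⟨r, rfl⟩ := (mixedIndexEquiv k l).surjective r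
  rw [linearRoots, withConj_mixedIndexEquiv, ← (mixedIndexEquiv k l).sum_comp]
  simp only [mixedMatrix, Matrix.reindex_apply, Matrix.submatrix_apply, Equiv.symm_apply_apply,
    Fintype.sum_sum_type, mixedPoint]
  rcases r with r | r | r
  · simp [Matrix.one_apply]
  · simp [Matrix.one_apply, Complex.ext_iff]
  · simp [Matrix.one_apply, Complex.ext_iff]

theorem hasRealProducts_mixedMatrix (k l : ℕ) : HasRealProducts (mixedMatrix k l) := fun u =>
  ⟨mixedPoly (mixedPoint u).1 (mixedPoint u).2, by rw [map_mixedPoly, linearRoots_mixedMatrix]⟩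

/-- Each conjugate pair contributes the block with rows `(1, i)` and `(1, -i)`, of determinant
`-2i`. This is the source of the factor `2 ^ l` in the theorem. -/
theorem norm_det_mixedMatrix (k l : ℕ) : ‖(mixedMatrix k l).det‖ = 2 ^ l := by
  have h : (-Complex.I • 1 - 1 * (Complex.I • 1) : Matrix (Fin l) (Fin l) ℂ) =
      (-2 * Complex.I) • 1 := by
    rw [one_mul, ← sub_smul]
    congr 1
    ring
  rw [mixedMatrix, Matrix.det_reindex_self, Matrix.det_fromBlocks_zero₂₁,
    Matrix.det_fromBlocks_one₁₁, h, Matrix.det_smul]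
  simp

/-- Real coordinates on `ℝᵏ × ℂˡ` together with `N` further real coordinates. -/
def mixedParam {N : ℕ} (q : ((Fin k → ℝ) × (Fin l → ℂ)) × (Fin N → ℝ)) :
    Fin (k + 2 * l) ⊕ Fin N → ℝ :=
  Sum.elim (fun c => Sum.elim q.1.1 (Sum.elim (fun j => (q.1.2 j).re) fun j => (q.1.2 j).im)
    ((mixedIndexEquiv k l).symm c)) q.2

theorem mixedPoint_mixedParam {N : ℕ} (q : ((Fin k → ℝ) × (Fin l → ℂ)) × (Fin N → ℝ)) :
    mixedPoint (mixedParam q ∘ Sum.inl) = q.1 := by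
  ext i <;> simp [mixedPoint, mixedParam]

theorem mixedParam_mixedPoint {N : ℕ} (v : Fin (k + 2 * l) ⊕ Fin N → ℝ) :
    mixedParam (mixedPoint (v ∘ Sum.inl), v ∘ Sum.inr) = v := by
  ext (c | c)
  · obtain ⟨c, rfl⟩ := (mixedIndexEquiv k l).surjective c
    rcases c with c | c | c <;> simp [mixedPoint, mixedParam]
  · simp [mixedParam]

theorem continuous_mixedPoint :
    Continuous (mixedPoint : (Fin (k + 2 * l) → ℝ) → (Fin k → ℝ) × (Fin l → ℂ)) := by
  unfold mixedPoint
  refine Continuous.prodMk (by fun_prop) (continuous_pi fun j => ?_)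
  exact Complex.equivRealProdCLM.symm.continuous.comp
    (f := fun u : Fin (k + 2 * l) → ℝ => (u (mixedIndexEquiv k l (Sum.inr (Sum.inl j))),
      u (mixedIndexEquiv k l (Sum.inr (Sum.inr j))))) (by fun_prop)

/-- Only coordinates are rearranged, after `ℂ` is identified with `ℝ²` preserving area; no constant
arises here. -/
theorem measurePreserving_mixedParam (N : ℕ) :
    MeasurePreserving (mixedParam : ((Fin k → ℝ) × (Fin l → ℂ)) × (Fin N → ℝ) → _) := by
  have h1 : MeasurePreserving (fun z : Fin l → ℂ => fun j => ((z j).re, (z j).im)) :=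
    volume_preserving_pi fun _ => Complex.volume_preserving_equiv_real_prod
  have h2 := (volume_measurePreserving_arrowProdEquivProdArrow ℝ ℝ (Fin l)).comp h1
  have h3 := (volume_measurePreserving_sumPiEquivProdPi_symm fun _ : Fin l ⊕ Fin l => ℝ).comp h2
  have h4 := (volume_measurePreserving_sumPiEquivProdPi_symm
    fun _ : Fin k ⊕ (Fin l ⊕ Fin l) => ℝ).comp
      ((MeasurePreserving.id (volume : Measure (Fin k → ℝ))).prod h3)
  have h5 := (volume_measurePreserving_piCongrLeft (fun _ => ℝ) (mixedIndexEquiv k l)).comp h4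
  have h6 := (volume_measurePreserving_sumPiEquivProdPi_symm
    fun _ : Fin (k + 2 * l) ⊕ Fin N => ℝ).comp
      (h5.prod (MeasurePreserving.id (volume : Measure (Fin N → ℝ))))
  have key : ∀ F : ((Fin k → ℝ) × (Fin l → ℂ)) × (Fin N → ℝ) → Fin (k + 2 * l) ⊕ Fin N → ℝ,
      MeasurePreserving F → (∀ q, F q = mixedParam q) →
      MeasurePreserving (mixedParam : ((Fin k → ℝ) × (Fin l → ℂ)) × (Fin N → ℝ) → _) :=
    fun F hF h => (funext h : F = mixedParam) ▸ hF
  refine key _ h6 fun q => ?_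
  ext c
  rcases c with c | c
  · obtain ⟨c, rfl⟩ := (mixedIndexEquiv k l).surjective c
    simp only [mixedParam, Sum.elim_inl, Equiv.symm_apply_apply]
    refine (MeasurableEquiv.piCongrLeft_apply_apply (β := fun _ => ℝ)
      (mixedIndexEquiv k l) _ c).trans ?_
    rcases c with c | c | c <;> rfl
  · rfl

end MixedCoordinates

/-! ### Fibres of the coefficient map as tuples of zeros. -/

section FiberCount
open Polynomial
open scoped ENNReal

/-- The polynomial function with real coefficients `b`. -/
def realPoly {n : ℕ} (b : Fin (n + 1) → ℝ) (z : ℂ) : ℂ :=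
  ∑ i : Fin (n + 1), (b i : ℂ) * z ^ (i : ℕ)

theorem realPoly_eq_aeval {n : ℕ} (b : Fin (n + 1) → ℝ) (z : ℂ) :
    realPoly b z = aeval z (ofFn (n + 1) b) :=
  (aeval_ofFn b z).symm

theorem realPoly_conj {n : ℕ} (b : Fin (n + 1) → ℝ) (z : ℂ) :
    realPoly b ((starRingEnd ℂ) z) = (starRingEnd ℂ) (realPoly b z) := by
  simp [realPoly]

theorem zeroMeasure_apply (g : ℂ → ℂ) {B : Set ℂ} (hB : MeasurableSet B) :
    zeroMeasure g B = (({z ∈ B | g z = 0}.encard : ℕ∞) : ℝ≥0∞) := by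
  rw [zeroMeasure, Measure.sum_apply _ hB, ← ENNReal.tsum_set_one]
  simp only [Measure.dirac_apply' _ hB]
  rw [show (∑' i : {z // g z = 0}, B.indicator (1 : ℂ → ℝ≥0∞) (i : ℂ)) =
      ∑' i : {z | g z = 0}, B.indicator (1 : ℂ → ℝ≥0∞) (i : ℂ) from rfl,
    tsum_subtype {z | g z = 0} (B.indicator (1 : ℂ → ℝ≥0∞)),
    tsum_subtype {z ∈ B | g z = 0} (fun _ => (1 : ℝ≥0∞))]
  refine tsum_congr fun z => ?_
  by_cases h1 : g z = 0 <;> by_cases h2 : z ∈ B <;> simp [Set.indicator, h1, h2]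

theorem zeroMeasure_ofReal_image (g : ℂ → ℂ) {A : Set ℝ} (hA : MeasurableSet A) :
    zeroMeasure g (Complex.ofReal '' A) = (({x ∈ A | g (x : ℂ) = 0}.encard : ℕ∞) : ℝ≥0∞) := by
  have hemb : MeasurableEmbedding Complex.ofReal :=
    Complex.isometry_ofReal.isClosedEmbedding.measurableEmbedding
  rw [zeroMeasure_apply g (hemb.measurableSet_image.2 hA)]
  congr 1
  rw [← Complex.ofReal_injective.encard_image]
  congr 1
  ext z
  constructor
  · rintro ⟨⟨x, hx, rfl⟩, h⟩
    exact ⟨x, ⟨hx, h⟩, rfl⟩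
  · rintro ⟨x, ⟨hx, h⟩, rfl⟩
    exact ⟨⟨x, hx, rfl⟩, h⟩

/-- A nonzero real polynomial of degree at most `n` has at most `n` complex zeros. -/
theorem encard_zeros_le {n : ℕ} {b : Fin (n + 1) → ℝ} (hb : b ≠ 0) :
    {z | realPoly b z = 0}.encard ≤ n := by
  have hne : (ofFn (n + 1) b).map (algebraMap ℝ ℂ) ≠ 0 := by
    rw [Polynomial.map_ne_zero_iff (algebraMap ℝ ℂ).injective]
    intro h
    exact hb (injective_ofFn (n + 1) (h.trans (map_zero _).symm))
  have : {z | realPoly b z = 0} =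
      ((((ofFn (n + 1) b).map (algebraMap ℝ ℂ)).roots.toFinset : Finset ℂ) : Set ℂ) := by
    ext z
    simp only [Set.mem_ofPred_eq, Finset.mem_coe, Multiset.mem_toFinset, mem_roots hne, IsRoot.def,
      realPoly_eq_aeval, eval_map, aeval_def]
  rw [this, Set.encard_coe_eq_coe_finsetCard]
  have h1 := Multiset.toFinset_card_le ((ofFn (n + 1) b).map (algebraMap ℝ ℂ)).roots
  have h2 := card_roots' ((ofFn (n + 1) b).map (algebraMap ℝ ℂ))
  rw [natDegree_map] at h2
  have h3 := ofFn_natDegree_lt (by omega : 1 ≤ n + 1) b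
  exact_mod_cast (by omega : _ ≤ n)

/-- The sign of the imaginary part separates the three groups of points. -/
theorem injective_withConj {k l : ℕ} {x : Fin k → ℝ} {z : Fin l → ℂ} (hx : Function.Injective x)
    (hz : Function.Injective z) (hz0 : ∀ j, z j ∈ upperC) : Function.Injective (withConj x z) := by
  have h0 : ∀ j, 0 < (z j).im := hz0
  have key : Function.Injective fun i => withConj x z (mixedIndexEquiv k l i) := by
    intro i i' h
    simp only [withConj_mixedIndexEquiv] at h
    have him := congrArg Complex.im h
    rcases i with i | i | i <;> rcases i' with i' | i' | i' <;>
      simp only [Sum.elim_inl, Sum.elim_inr, Complex.ofReal_im, Complex.conj_im] at h him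
    · rw [hx (Complex.ofReal_injective h)]
    · linarith [h0 i']
    · linarith [h0 i']
    · linarith [h0 i]
    · rw [hz h]
    · linarith [h0 i, h0 i']
    · linarith [h0 i]
    · linarith [h0 i, h0 i']
    · rw [hz ((starRingEnd ℂ).injective h)]
  intro r r' h
  obtain ⟨i, rfl⟩ := (mixedIndexEquiv k l).surjective r
  obtain ⟨i', rfl⟩ := (mixedIndexEquiv k l).surjective r'
  rw [key h]

theorem absVandermonde_ne_zero {m : ℕ} {w : Fin m → ℂ} (hw : Function.Injective w) :
    absVandermonde w ≠ 0 := by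
  rw [← norm_det_vandermonde, norm_ne_zero_iff, Matrix.det_vandermonde_ne_zero_iff]
  exact hw

variable {n k l : ℕ}

theorem rootsToCoeffs_mixedParam (hm : k + 2 * l ≤ n)
    (q : ((Fin k → ℝ) × (Fin l → ℂ)) × (Fin (n - (k + 2 * l) + 1) → ℝ)) :
    rootsToCoeffs hm (mixedMatrix k l) (mixedParam q) =
      productCoeff n (withConj q.1.1 q.1.2) q.2 ∘ sumEquivFin hm := by
  ext c
  rw [rootsToCoeffs, linearRoots_mixedMatrix, mixedPoint_mixedParam]
  rfl

theorem productCoeff_withConj_eq_iff (hm : k + 2 * l ≤ n) (p : (Fin k → ℝ) × (Fin l → ℂ))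
    (t : Fin (n - (k + 2 * l) + 1) → ℝ) (b : Fin (n + 1) → ℝ) :
    productCoeff n (withConj p.1 p.2) t = b ↔
      mixedPoly p.1 p.2 * ofFn (n - (k + 2 * l) + 1) t = ofFn (n + 1) b := by
  rw [← ofFn_productCoeff hm (map_mixedPoly p.1 p.2), (injective_ofFn (n + 1)).eq_iff]

/-- The set of parameters whose roots lie in a given set. -/
def paramsOver (n : ℕ) (S : Set ((Fin k → ℝ) × (Fin l → ℂ))) :
    Set (Fin (k + 2 * l) ⊕ Fin (n - (k + 2 * l) + 1) → ℝ) :=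
  {v | mixedPoint (v ∘ Sum.inl) ∈ S}

/-- Distinct roots give coprime linear factors, so their product divides over `ℂ`. Both polynomials
are real, so divisibility descends to `ℝ`, and the degrees bound the size of the cofactor. -/
theorem exists_mixedPoly_mul_eq (hm : k + 2 * l ≤ n) {b : Fin (n + 1) → ℝ} (hb : b ≠ 0)
    {p : (Fin k → ℝ) × (Fin l → ℂ)} (hinj : Function.Injective (withConj p.1 p.2))
    (hx : ∀ i, realPoly b (p.1 i) = 0) (hz : ∀ j, realPoly b (p.2 j) = 0) :
    ∃ t : Fin (n - (k + 2 * l) + 1) → ℝ,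
      mixedPoly p.1 p.2 * ofFn (n - (k + 2 * l) + 1) t = ofFn (n + 1) b := by
  have hroot : ∀ r, realPoly b (withConj p.1 p.2 r) = 0 := by
    intro r
    obtain ⟨i, rfl⟩ := (mixedIndexEquiv k l).surjective r
    rw [withConj_mixedIndexEquiv]
    rcases i with i | i | i
    · exact hx i
    · exact hz i
    · simp [realPoly_conj, hz i]
  have hdvd : (mixedPoly p.1 p.2).map Complex.ofRealHom ∣
      (ofFn (n + 1) b).map Complex.ofRealHom := by
    rw [map_mixedPoly]
    refine Fintype.prod_dvd_of_coprime (pairwise_coprime_X_sub_C hinj) fun r => ?_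
    rw [dvd_iff_isRoot, IsRoot.def, eval_map]
    have := hroot r
    rwa [realPoly_eq_aeval, aeval_def] at this
  obtain ⟨q, hq⟩ := (map_dvd_map' Complex.ofRealHom).1 hdvd
  have hne : ofFn (n + 1) b ≠ 0 := fun h => hb (injective_ofFn (n + 1) (h.trans (map_zero _).symm))
  have hq0 : q ≠ 0 := by
    rintro rfl
    exact hne (by rw [hq, mul_zero])
  have hdeg := congrArg natDegree hq
  rw [natDegree_mul (mixedPoly_ne_zero _ _) hq0, natDegree_mixedPoly] at hdeg
  have hlt := ofFn_natDegree_lt (by omega : 1 ≤ n + 1) b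
  refine ⟨toFn (n - (k + 2 * l) + 1) q, ?_⟩
  rw [ofFn_comp_toFn_eq_id_of_natDegree_lt (by omega), hq]

/-- The number of preimages of a nonzero polynomial is the number of tuples of its zeros. -/
theorem encard_paramsOver_fiber (hm : k + 2 * l ≤ n) {A : Fin k → Set ℝ} {B : Fin l → Set ℂ}
    (hB : ∀ j, B j ⊆ upperC) (hA : Pairwise fun i i' => Disjoint (A i) (A i'))
    (hBd : Pairwise fun j j' => Disjoint (B j) (B j')) {b : Fin (n + 1) → ℝ} (hb : b ≠ 0) :
    (paramsOver n ((Set.univ.pi A) ×ˢ (Set.univ.pi B)) ∩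
      rootsToCoeffs hm (mixedMatrix k l) ⁻¹' {b ∘ sumEquivFin hm}).encard =
      (∏ i, {x ∈ A i | realPoly b (x : ℂ) = 0}.encard) *
        ∏ j, {z ∈ B j | realPoly b z = 0}.encard := by
  rw [← Set.encard_pi_eq_prod_encard, ← Set.encard_pi_eq_prod_encard, ← Set.encard_prod]
  have hmem : ∀ v, rootsToCoeffs hm (mixedMatrix k l) v = b ∘ sumEquivFin hm ↔
      mixedPoly (mixedPoint (v ∘ Sum.inl)).1 (mixedPoint (v ∘ Sum.inl)).2 *
        ofFn (n - (k + 2 * l) + 1) (v ∘ Sum.inr) = ofFn (n + 1) b := by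
    intro v
    conv_lhs => rw [← mixedParam_mixedPoint v, rootsToCoeffs_mixedParam]
    rw [(sumEquivFin hm).surjective.injective_comp_right.eq_iff, ← productCoeff_withConj_eq_iff hm]
  -- Forgetting the cofactor is a bijection onto tuples of zeros. It is injective since the cofactor
  -- is determined by cancellation, and surjective since disjointness of the sets makes the chosen
  -- zeros distinct.
  refine Set.encard_congr (Set.BijOn.equiv (fun v => mixedPoint (v ∘ Sum.inl)) ⟨?_, ?_, ?_⟩)
  · rintro v ⟨⟨hvA, hvB⟩, hv⟩
    have hv' := (hmem v).1 hv
    have hzero : ∀ r, realPoly b (withConj (mixedPoint (v ∘ Sum.inl)).1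
        (mixedPoint (v ∘ Sum.inl)).2 r) = 0 := by
      intro r
      rw [realPoly_eq_aeval, ← hv', map_mul, aeval_def, ← eval_map,
        show algebraMap ℝ ℂ = Complex.ofRealHom from rfl, map_mixedPoly, eval_prod,
        Finset.prod_eq_zero (Finset.mem_univ r) (by simp), zero_mul]
    refine ⟨fun i _ => ⟨hvA i trivial, ?_⟩, fun j _ => ⟨hvB j trivial, ?_⟩⟩
    · simpa [withConj_mixedIndexEquiv] using hzero (mixedIndexEquiv k l (Sum.inl i))
    · simpa [withConj_mixedIndexEquiv] using hzero (mixedIndexEquiv k l (Sum.inr (Sum.inl j)))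
  · rintro v ⟨-, hv⟩ v' ⟨-, hv'⟩ h
    simp only at h
    have h1 := (hmem v).1 hv
    have h2 := (hmem v').1 hv'
    rw [← h2, ← h] at h1
    have h3 := injective_ofFn _ (mul_left_cancel₀ (mixedPoly_ne_zero _ _) h1)
    rw [← mixedParam_mixedPoint v, ← mixedParam_mixedPoint v', h, h3]
  · rintro p ⟨hp1, hp2⟩
    have hx : Function.Injective p.1 := by
      intro i i' h
      by_contra hne
      exact Set.disjoint_left.1 (hA hne) (hp1 i trivial).1 (h ▸ (hp1 i' trivial).1)
    have hz : Function.Injective p.2 := by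
      intro i i' h
      by_contra hne
      exact Set.disjoint_left.1 (hBd hne) (hp2 i trivial).1 (h ▸ (hp2 i' trivial).1)
    obtain ⟨t, ht⟩ := exists_mixedPoly_mul_eq hm hb
      (injective_withConj hx hz fun j => hB j (hp2 j trivial).1)
      (fun i => (hp1 i trivial).2) (fun j => (hp2 j trivial).2)
    refine ⟨mixedParam (p, t), ⟨?_, ?_⟩, mixedPoint_mixedParam _⟩
    · rw [paramsOver, Set.mem_ofPred_eq, mixedPoint_mixedParam]
      exact ⟨fun i _ => (hp1 i trivial).1, fun j _ => (hp2 j trivial).1⟩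
    · rw [Set.mem_preimage, Set.mem_singleton_iff, hmem, mixedPoint_mixedParam]
      exact ht

end FiberCount

/-! ### The joint law of the coefficients. -/

section Law
open scoped ENNReal

/-- Tonelli's theorem, by induction, splitting off the first coordinate. -/
theorem lintegral_fin_prod_eq_prod {N : ℕ} (μ : Fin N → Measure ℝ) [∀ i, SigmaFinite (μ i)]
    {g : Fin N → ℝ → ℝ≥0∞} (hg : ∀ i, Measurable (g i)) :
    ∫⁻ x, ∏ i, g i (x i) ∂(Measure.pi μ) = ∏ i, ∫⁻ x, g i x ∂(μ i) := by
  induction N with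
  | zero => simp
  | succ N ih =>
    have hm : Measurable fun y : ℝ × (Fin N → ℝ) => ∏ i, g i.succ (y.2 i) :=
      Finset.measurable_fun_prod _ fun i _ => (hg i.succ).comp (by fun_prop)
    have hmp := (measurePreserving_piFinSuccAbove μ 0).lintegral_comp
      (f := fun y : ℝ × (Fin N → ℝ) => g 0 y.1 * ∏ i, g i.succ (y.2 i))
      (((hg 0).comp measurable_fst).mul hm)
    rw [lintegral_prod_mul (g := fun y : Fin N → ℝ => ∏ i, g i.succ (y i)) (hg 0).aemeasurable
      (Finset.measurable_fun_prod _ fun i _ =>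
        (hg i.succ).comp (measurable_pi_apply i)).aemeasurable] at hmp
    simp_rw [Fin.prod_univ_succ]
    rw [← ih (fun i => μ i.succ) fun i => hg i.succ]
    exact hmp

theorem pi_withDensity {N : ℕ} {g : Fin N → ℝ → ℝ≥0∞} (hg : ∀ i, Measurable (g i))
    [∀ i, SigmaFinite ((volume : Measure ℝ).withDensity (g i))] :
    Measure.pi (fun i => (volume : Measure ℝ).withDensity (g i)) =
      (volume : Measure (Fin N → ℝ)).withDensity fun b => ∏ i, g i (b i) := by
  refine Measure.pi_eq fun s hs => ?_
  rw [withDensity_apply _ (MeasurableSet.univ_pi hs), volume_pi, Measure.restrict_pi_pi,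
    lintegral_fin_prod_eq_prod _ hg]
  exact Finset.prod_congr rfl fun i _ => (withDensity_apply _ (hs i)).symm

variable {Ω : Type*} [MeasurableSpace Ω] {P : Measure Ω} [IsProbabilityMeasure P] {n : ℕ}
  {f : Fin (n + 1) → ℝ → ℝ} {ξ : Fin (n + 1) → Ω → ℝ}

/-- The joint density of the coefficients. -/
theorem map_coeffs_eq_withDensity (hf_meas : ∀ i, Measurable (f i)) (hξ_meas : ∀ i, Measurable (ξ i))
    (hξ_indep : iIndepFun ξ P)
    (hξ_density : ∀ i, P.map (ξ i) = volume.withDensity (fun t => ENNReal.ofReal (f i t))) :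
    P.map (fun ω i => ξ i ω) =
      volume.withDensity fun b : Fin (n + 1) → ℝ => ∏ i, ENNReal.ofReal (f i (b i)) := by
  have : ∀ i, SigmaFinite ((volume : Measure ℝ).withDensity fun t => ENNReal.ofReal (f i t)) := by
    intro i
    rw [← hξ_density i]
    have := Measure.isProbabilityMeasure_map (μ := P) (hξ_meas i).aemeasurable
    infer_instance
  rw [(iIndepFun_iff_map_fun_eq_pi_map fun i => (hξ_meas i).aemeasurable).1 hξ_indep]
  simp only [hξ_density]
  exact pi_withDensity fun i => (hf_meas i).ennreal_ofReal

end Law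

/-! ### Continuity, measurability and signs of the ingredients of `rho`. -/

section Continuity

theorem continuous_withConj {k l : ℕ} :
    Continuous fun p : (Fin k → ℝ) × (Fin l → ℂ) => withConj p.1 p.2 := by
  refine continuous_pi fun r => ?_
  obtain ⟨i, rfl⟩ := (mixedIndexEquiv k l).surjective r
  simp only [withConj_mixedIndexEquiv]
  rcases i with i | i | i <;> simp only [Sum.elim_inl, Sum.elim_inr]
  · exact Complex.continuous_ofReal.comp (by fun_prop)
  · fun_prop
  · exact Complex.continuous_conj.comp (by fun_prop)

theorem continuous_elemSymm {m : ℕ} (r : ℤ) : Continuous (elemSymm (m := m) r) := by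
  unfold elemSymm
  split_ifs
  · fun_prop
  · exact continuous_const

theorem continuous_productCoeff (n : ℕ) {m : ℕ} (i : Fin (n + 1)) :
    Continuous fun q : (Fin m → ℂ) × (Fin (n - m + 1) → ℝ) => productCoeff n q.1 q.2 i := by
  unfold productCoeff
  refine continuous_finsetSum _ fun j _ => ?_
  have h1 : Continuous fun q : (Fin m → ℂ) × (Fin (n - m + 1) → ℝ) =>
      (elemSymm ((m : ℤ) - (i : ℕ) + (j : ℕ)) q.1).re :=
    Complex.continuous_re.comp ((continuous_elemSymm _).comp continuous_fst)
  fun_prop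

theorem continuous_absVandermonde {m : ℕ} : Continuous (absVandermonde (m := m)) := by
  unfold absVandermonde
  fun_prop

theorem rhoIntegrand_eq {n m : ℕ} (f : Fin (n + 1) → ℝ → ℝ) (w : Fin m → ℂ)
    (t : Fin (n - m + 1) → ℝ) :
    rhoIntegrand n f w t = (∏ i, f i (productCoeff n w t i)) *
      ∏ i, ‖∑ j : Fin (n - m + 1), (t j : ℂ) * w i ^ (j : ℕ)‖ := rfl

theorem measurable_rhoIntegrand {n m : ℕ} {f : Fin (n + 1) → ℝ → ℝ} (hf : ∀ i, Measurable (f i)) :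
    Measurable fun q : (Fin m → ℂ) × (Fin (n - m + 1) → ℝ) => rhoIntegrand n f q.1 q.2 := by
  simp only [rhoIntegrand_eq]
  refine Measurable.mul (Finset.measurable_fun_prod _ fun i _ =>
    (hf i).comp (continuous_productCoeff n i).measurable) ?_
  refine Continuous.measurable ?_
  have : ∀ j, Continuous fun q : (Fin m → ℂ) × (Fin (n - m + 1) → ℝ) => (q.2 j : ℂ) := fun j =>
    Complex.continuous_ofReal.comp (by fun_prop)
  fun_prop

theorem measurable_rhoIntegrand_right {n m : ℕ} {f : Fin (n + 1) → ℝ → ℝ}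
    (hf : ∀ i, Measurable (f i)) (w : Fin m → ℂ) : Measurable (rhoIntegrand n f w) :=
  Measurable.comp
    (g := fun q : (Fin m → ℂ) × (Fin (n - m + 1) → ℝ) => rhoIntegrand n f q.1 q.2)
    (f := fun t => (w, t)) (measurable_rhoIntegrand hf) (measurable_const.prodMk measurable_id)

theorem rhoIntegrand_nonneg {n m : ℕ} {f : Fin (n + 1) → ℝ → ℝ} (hf : ∀ i t, 0 ≤ f i t)
    (w : Fin m → ℂ) (t : Fin (n - m + 1) → ℝ) : 0 ≤ rhoIntegrand n f w t :=
  mul_nonneg (Finset.prod_nonneg fun i _ => hf i _) (Finset.prod_nonneg fun _ _ => norm_nonneg _)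

theorem absVandermonde_nonneg {m : ℕ} (w : Fin m → ℂ) : 0 ≤ absVandermonde w :=
  Finset.prod_nonneg fun _ _ => Finset.prod_nonneg fun _ _ => norm_nonneg _

end Continuity

/-! ### The expected number of tuples of zeros. -/

section Expectation
open scoped ENNReal

variable {n k l : ℕ}

/-- The mixed correlation function, with values in `[0, ∞]`. -/
def mixedDensity (n : ℕ) (f : Fin (n + 1) → ℝ → ℝ) (p : (Fin k → ℝ) × (Fin l → ℂ)) : ℝ≥0∞ :=
  ENNReal.ofReal (2 ^ l * absVandermonde (withConj p.1 p.2)) *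
    ∫⁻ t, ENNReal.ofReal (rhoIntegrand n f (withConj p.1 p.2) t)

theorem measurable_rhoIntegrand_withConj {f : Fin (n + 1) → ℝ → ℝ} (hf : ∀ i, Measurable (f i)) :
    Measurable fun q : ((Fin k → ℝ) × (Fin l → ℂ)) × (Fin (n - (k + 2 * l) + 1) → ℝ) =>
      rhoIntegrand n f (withConj q.1.1 q.1.2) q.2 :=
  Measurable.comp (g := fun q : (Fin (k + 2 * l) → ℂ) × (Fin (n - (k + 2 * l) + 1) → ℝ) =>
      rhoIntegrand n f q.1 q.2)
    (f := fun q : ((Fin k → ℝ) × (Fin l → ℂ)) × (Fin (n - (k + 2 * l) + 1) → ℝ) =>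
      (withConj q.1.1 q.1.2, q.2))
    (measurable_rhoIntegrand hf)
    ((continuous_withConj.measurable.comp measurable_fst).prodMk measurable_snd)

theorem measurable_mixedDensity {f : Fin (n + 1) → ℝ → ℝ} (hf : ∀ i, Measurable (f i)) :
    Measurable (mixedDensity (k := k) (l := l) n f) := by
  refine Measurable.mul ?_ ?_
  · exact ((continuous_absVandermonde.comp continuous_withConj).measurable.const_mul _).ennreal_ofReal
  · exact (measurable_rhoIntegrand_withConj hf).ennreal_ofReal.lintegral_prod_right'

/-- The number of tuples of zeros in given sets. -/
def zeroCount (A : Fin k → Set ℝ) (B : Fin l → Set ℂ) (g : ℂ → ℂ) : ℝ≥0∞ :=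
  (∏ i, zeroMeasure g (Complex.ofReal '' A i)) * ∏ j, zeroMeasure g (B j)

/-- Disjoint Borel sets, on the real line and in the upper half-plane. -/
structure IsDisjointFamily (A : Fin k → Set ℝ) (B : Fin l → Set ℂ) : Prop where
  measurable_left : ∀ i, MeasurableSet (A i)
  measurable_right : ∀ j, MeasurableSet (B j)
  subset : ∀ j, B j ⊆ upperC
  disjoint_left : Pairwise fun i i' => Disjoint (A i) (A i')
  disjoint_right : Pairwise fun j j' => Disjoint (B j) (B j')

variable {A : Fin k → Set ℝ} {B : Fin l → Set ℂ}

theorem IsDisjointFamily.injective_withConj (h : IsDisjointFamily A B)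
    {p : (Fin k → ℝ) × (Fin l → ℂ)} (hp : p ∈ (Set.univ.pi A) ×ˢ (Set.univ.pi B)) :
    Function.Injective (withConj p.1 p.2) := by
  refine _root_.injective_withConj ?_ ?_ fun j => h.subset j (hp.2 j trivial)
  · intro i i' he
    by_contra hne
    exact Set.disjoint_left.1 (h.disjoint_left hne) (hp.1 i trivial) (he ▸ hp.1 i' trivial)
  · intro i i' he
    by_contra hne
    exact Set.disjoint_left.1 (h.disjoint_right hne) (hp.2 i trivial) (he ▸ hp.2 i' trivial)

theorem IsDisjointFamily.measurableSet_prod (h : IsDisjointFamily A B) :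
    MeasurableSet ((Set.univ.pi A) ×ˢ (Set.univ.pi B)) :=
  (MeasurableSet.univ_pi h.measurable_left).prod (MeasurableSet.univ_pi h.measurable_right)

theorem zeroCount_eq_encard_fiber (hm : k + 2 * l ≤ n) (h : IsDisjointFamily A B)
    {b : Fin (n + 1) → ℝ} (hb : b ≠ 0) :
    zeroCount A B (realPoly b) = (((paramsOver n ((Set.univ.pi A) ×ˢ (Set.univ.pi B)) ∩
      rootsToCoeffs hm (mixedMatrix k l) ⁻¹' {b ∘ sumEquivFin hm}).encard : ℕ∞) : ℝ≥0∞) := by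
  rw [encard_paramsOver_fiber hm h.subset h.disjoint_left h.disjoint_right hb, zeroCount]
  simp only [zeroMeasure_ofReal_image _ (h.measurable_left _),
    zeroMeasure_apply _ (h.measurable_right _)]
  rw [ENat.toENNReal_mul]
  congr 1
  · exact (map_prod ENat.toENNRealRingHom _ _).symm
  · exact (map_prod ENat.toENNRealRingHom _ _).symm

theorem piCongrLeft_symm_sumEquivFin {m : ℕ} (hm : m ≤ n) :
    ⇑(MeasurableEquiv.piCongrLeft (fun _ => ℝ) (sumEquivFin hm).symm) =
      fun b : Fin (n + 1) → ℝ => b ∘ sumEquivFin hm := by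
  ext b c
  obtain ⟨i, rfl⟩ := (sumEquivFin hm).symm.surjective c
  refine (MeasurableEquiv.piCongrLeft_apply_apply (β := fun _ => ℝ)
    (sumEquivFin hm).symm b i).trans ?_
  simp

theorem measurePreserving_comp_sumEquivFin {m : ℕ} (hm : m ≤ n) :
    MeasurePreserving (fun b : Fin (n + 1) → ℝ => b ∘ sumEquivFin hm) :=
  piCongrLeft_symm_sumEquivFin hm ▸
    volume_measurePreserving_piCongrLeft (fun _ => ℝ) (sumEquivFin hm).symm

theorem measurableEmbedding_comp_sumEquivFin {m : ℕ} (hm : m ≤ n) :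
    MeasurableEmbedding (fun b : Fin (n + 1) → ℝ => b ∘ sumEquivFin hm) :=
  piCongrLeft_symm_sumEquivFin hm ▸
    (MeasurableEquiv.piCongrLeft (fun _ => ℝ) (sumEquivFin hm).symm).measurableEmbedding

theorem measurableSet_paramsOver {S : Set ((Fin k → ℝ) × (Fin l → ℂ))} (hS : MeasurableSet S) :
    MeasurableSet (paramsOver n S) :=
  (continuous_mixedPoint.comp (continuous_pi fun i => continuous_apply (Sum.inl i))).measurable hS

theorem ae_coeffs_ne_zero (n : ℕ) : ∀ᵐ b : Fin (n + 1) → ℝ, b ≠ 0 :=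
  Measure.ae_ne volume 0

theorem measurable_det_fderiv {ι : Type*} [Fintype ι] (Φ : (ι → ℝ) → ι → ℝ) :
    Measurable fun v => (fderiv ℝ Φ v).det :=
  ContinuousLinearMap.continuous_det.measurable.comp (measurable_fderiv ℝ Φ)

/-- Off the null set `{0}` the count is a fibre cardinality, whose measurability comes from the area
formula section. -/
theorem aemeasurable_zeroCount (hm : k + 2 * l ≤ n) (h : IsDisjointFamily A B) :
    AEMeasurable fun b : Fin (n + 1) → ℝ => zeroCount A B (realPoly b) := by
  have h1 := aemeasurable_encard_fiber volume
    (fun v => (differentiable_rootsToCoeffs hm (mixedMatrix k l) v).hasFDerivAt)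
    (measurable_det_fderiv _) (measurableSet_paramsOver (n := n) h.measurableSet_prod)
  refine (h1.comp_quasiMeasurePreserving
    (measurePreserving_comp_sumEquivFin hm).quasiMeasurePreserving).congr ?_
  filter_upwards [ae_coeffs_ne_zero n] with b hb
  exact (zeroCount_eq_encard_fiber hm h hb).symm

/-- The heart of the proof: the area formula with the joint density as weight, then the Jacobian,
then Tonelli in the cofactor `t`. -/
theorem lintegral_density_mul_zeroCount (hm : k + 2 * l ≤ n) (h : IsDisjointFamily A B)
    {f : Fin (n + 1) → ℝ → ℝ} (hf_meas : ∀ i, Measurable (f i)) (hf_nonneg : ∀ i t, 0 ≤ f i t) :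
    ∫⁻ b : Fin (n + 1) → ℝ, (∏ i, ENNReal.ofReal (f i (b i))) * zeroCount A B (realPoly b) =
      ∫⁻ p in (Set.univ.pi A) ×ˢ (Set.univ.pi B), mixedDensity n f p := by
  set S := (Set.univ.pi A) ×ˢ (Set.univ.pi B) with hS
  have hSm : MeasurableSet S := h.measurableSet_prod
  let Ψ := rootsToCoeffs hm (mixedMatrix k l)
  let g : (Fin (k + 2 * l) ⊕ Fin (n - (k + 2 * l) + 1) → ℝ) → ℝ≥0∞ := fun a =>
    ∏ i, ENNReal.ofReal (f i (a ((sumEquivFin hm).symm i)))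
  have hg : Measurable g := Finset.measurable_fun_prod _ fun i _ =>
    ((hf_meas i).comp (measurable_pi_apply _)).ennreal_ofReal
  have h1 : ∫⁻ b : Fin (n + 1) → ℝ,
      (∏ i, ENNReal.ofReal (f i (b i))) * zeroCount A B (realPoly b) =
      ∫⁻ a, (((paramsOver n S ∩ Ψ ⁻¹' {a}).encard : ℕ∞) : ℝ≥0∞) * g a := by
    rw [← (measurePreserving_comp_sumEquivFin hm).lintegral_comp_emb
      (measurableEmbedding_comp_sumEquivFin hm)]
    refine lintegral_congr_ae ?_
    filter_upwards [ae_coeffs_ne_zero n] with b hb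
    rw [zeroCount_eq_encard_fiber hm h hb, mul_comm]
    simp [g, Ψ, hS]
  rw [h1, lintegral_encard_fiber_mul volume
    (fun v => (differentiable_rootsToCoeffs hm (mixedMatrix k l) v).hasFDerivAt)
    (measurable_det_fderiv _) (measurableSet_paramsOver hSm) hg]
  let H : (Fin (k + 2 * l) ⊕ Fin (n - (k + 2 * l) + 1) → ℝ) → ℝ≥0∞ := fun v =>
    ENNReal.ofReal |(fderiv ℝ Ψ v).det| * g (Ψ v)
  have hH : Measurable H := by
    refine (measurable_det_fderiv _).norm.ennreal_ofReal.mul (hg.comp ?_)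
    exact (differentiable_rootsToCoeffs hm (mixedMatrix k l)).continuous.measurable
  change ∫⁻ v in paramsOver n S, H v = _
  rw [← (measurePreserving_mixedParam (k := k) (l := l) _).setLIntegral_comp_preimage
    (measurableSet_paramsOver hSm) hH]
  have hpre : mixedParam ⁻¹' paramsOver n S =
      S ×ˢ (Set.univ : Set (Fin (n - (k + 2 * l) + 1) → ℝ)) := by
    ext q
    simp [paramsOver, mixedPoint_mixedParam]
  rw [hpre]
  -- Over `S` the roots are distinct, so the Vandermonde product is nonzero and the Jacobian formula
  -- applies.
  have hval : ∀ q ∈ S ×ˢ (Set.univ : Set (Fin (n - (k + 2 * l) + 1) → ℝ)), H (mixedParam q) =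
      ENNReal.ofReal (2 ^ l * absVandermonde (withConj q.1.1 q.1.2)) *
        ENNReal.ofReal (rhoIntegrand n f (withConj q.1.1 q.1.2) q.2) := by
    rintro q ⟨hq, -⟩
    have hroots : linearRoots (mixedMatrix k l) (mixedParam q ∘ Sum.inl) =
        withConj q.1.1 q.1.2 := by
      rw [linearRoots_mixedMatrix, mixedPoint_mixedParam]
    have hv : absVandermonde (linearRoots (mixedMatrix k l) (mixedParam q ∘ Sum.inl)) ≠ 0 := by
      rw [hroots]
      exact absVandermonde_ne_zero (h.injective_withConj hq)
    have hg' : g (Ψ (mixedParam q)) =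
        ENNReal.ofReal (∏ i, f i (productCoeff n (withConj q.1.1 q.1.2) q.2 i)) := by
      rw [ENNReal.ofReal_prod_of_nonneg fun i _ => hf_nonneg i _]
      simp [g, Ψ, rootsToCoeffs_mixedParam]
    simp only [H]
    rw [hg', abs_det_fderiv_rootsToCoeffs hm _ _ (hasRealProducts_mixedMatrix k l) hv, hroots,
      norm_det_mixedMatrix, rhoIntegrand_eq,
      ENNReal.ofReal_mul (mul_nonneg (by positivity) (absVandermonde_nonneg _)),
      ENNReal.ofReal_mul (Finset.prod_nonneg fun i _ => hf_nonneg i _), mul_assoc]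
    congr 1
    rw [mul_comm]
    rfl
  rw [setLIntegral_congr_fun (hSm.prod MeasurableSet.univ) hval, Measure.volume_eq_prod,
    ← Measure.prod_restrict, Measure.restrict_univ, lintegral_prod]
  · refine lintegral_congr fun p => ?_
    have hsec : Measurable fun t : Fin (n - (k + 2 * l) + 1) → ℝ =>
        ENNReal.ofReal (rhoIntegrand n f (withConj p.1 p.2) t) :=
      (measurable_rhoIntegrand_right hf_meas _).ennreal_ofReal
    rw [mixedDensity]
    exact lintegral_const_mul (μ := volume)
      (ENNReal.ofReal (2 ^ l * absVandermonde (withConj p.1 p.2))) hsec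
  · refine (Measurable.mul ?_ (measurable_rhoIntegrand_withConj hf_meas).ennreal_ofReal).aemeasurable
    exact (((continuous_absVandermonde.comp continuous_withConj).measurable.comp
      measurable_fst).const_mul _).ennreal_ofReal

end Expectation

/-! ### Measurability of the zero count of an arbitrary Borel set. -/

section ZeroMeasurability
open scoped ENNReal

variable {n : ℕ}

theorem measurableSet_upperC : MeasurableSet upperC :=
  measurableSet_lt measurable_const Complex.measurable_im

theorem aemeasurable_zeroMeasure_ofReal_image (hn : 1 ≤ n) {A : Set ℝ} (hA : MeasurableSet A) :
    AEMeasurable fun b : Fin (n + 1) → ℝ => zeroMeasure (realPoly b) (Complex.ofReal '' A) := by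
  have h : IsDisjointFamily (fun _ : Fin 1 => A) (fun _ : Fin 0 => (∅ : Set ℂ)) :=
    ⟨fun _ => hA, fun _ => MeasurableSet.empty, fun _ => Set.empty_subset _,
      fun i i' hne => absurd (Subsingleton.elim i i') hne,
      fun i i' hne => absurd (Subsingleton.elim i i') hne⟩
  simpa [zeroCount] using aemeasurable_zeroCount (n := n) (by omega) h

theorem aemeasurable_zeroMeasure_of_subset_upperC {B : Set ℂ} (hB : MeasurableSet B)
    (hsub : B ⊆ upperC) :
    AEMeasurable fun b : Fin (n + 1) → ℝ => zeroMeasure (realPoly b) B := by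
  rcases le_or_gt 2 n with hn | hn
  · have h : IsDisjointFamily (fun _ : Fin 0 => (∅ : Set ℝ)) (fun _ : Fin 1 => B) :=
      ⟨fun _ => MeasurableSet.empty, fun _ => hB, fun _ => hsub,
        fun i i' hne => absurd (Subsingleton.elim i i') hne,
        fun i i' hne => absurd (Subsingleton.elim i i') hne⟩
    simpa [zeroCount] using aemeasurable_zeroCount (n := n) (by omega) h
  -- For `n < 2` the case `k = 0`, `l = 1` of the count is unavailable, but a nonreal zero would
  -- bring its conjugate and exceed the degree.
  · refine (aemeasurable_const (b := (0 : ℝ≥0∞))).congr ?_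
    filter_upwards [ae_coeffs_ne_zero n] with b hb
    rw [zeroMeasure_apply _ hB]
    have : {z ∈ B | realPoly b z = 0} = ∅ := by
      rw [Set.eq_empty_iff_forall_notMem]
      rintro z ⟨hz, h0⟩
      have him : 0 < z.im := hsub hz
      have hne : z ≠ (starRingEnd ℂ) z := by
        intro h
        have := congrArg Complex.im h
        rw [Complex.conj_im] at this
        linarith
      have hpair : ({z, (starRingEnd ℂ) z} : Set ℂ) ⊆ {z | realPoly b z = 0} := by
        rintro w (rfl | rfl)
        · exact h0
        · simp [realPoly_conj, h0]
      have h2 := (Set.encard_le_encard hpair).trans (encard_zeros_le hb)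
      rw [Set.encard_pair hne] at h2
      have : 2 ≤ n := by exact_mod_cast h2
      omega
    simp [this]

theorem zeroMeasure_conj_preimage (b : Fin (n + 1) → ℝ) {B : Set ℂ} (hB : MeasurableSet B) :
    zeroMeasure (realPoly b) (starRingEnd ℂ ⁻¹' B) = zeroMeasure (realPoly b) B := by
  rw [zeroMeasure_apply _ hB, zeroMeasure_apply _ (Complex.continuous_conj.measurable hB),
    ← (starRingEnd ℂ).injective.encard_image {z ∈ starRingEnd ℂ ⁻¹' B | realPoly b z = 0}]
  congr 2
  ext z
  constructor
  · rintro ⟨w, ⟨hw, h0⟩, rfl⟩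
    exact ⟨hw, by simp [realPoly_conj, h0]⟩
  · rintro ⟨hz, h0⟩
    exact ⟨(starRingEnd ℂ) z, ⟨by simpa using hz, by simp [realPoly_conj, h0]⟩, by simp⟩

/-- `B` splits into its real part, its part in the upper half-plane and its part in the lower one;
conjugation symmetry of the zeros reflects the last into the upper half-plane. -/
theorem aemeasurable_zeroMeasure (hn : 1 ≤ n) {B : Set ℂ} (hB : MeasurableSet B) :
    AEMeasurable fun b : Fin (n + 1) → ℝ => zeroMeasure (realPoly b) B := by
  have hconj : MeasurableSet (starRingEnd ℂ ⁻¹' B) := Complex.continuous_conj.measurable hB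
  have h : ∀ b : Fin (n + 1) → ℝ, zeroMeasure (realPoly b) B =
      zeroMeasure (realPoly b) (Complex.ofReal '' (Complex.ofReal ⁻¹' B)) +
        (zeroMeasure (realPoly b) (B ∩ upperC) +
          zeroMeasure (realPoly b) ((starRingEnd ℂ ⁻¹' B) ∩ upperC)) := by
    intro b
    have h1 : (starRingEnd ℂ ⁻¹' B) ∩ upperC =
        starRingEnd ℂ ⁻¹' (B ∩ (starRingEnd ℂ ⁻¹' upperC)) := by
      ext z; simp
    have hlow : MeasurableSet (starRingEnd ℂ ⁻¹' upperC) :=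
      Complex.continuous_conj.measurable measurableSet_upperC
    rw [h1, zeroMeasure_conj_preimage b (hB.inter hlow),
      ← measure_inter_add_sdiff B measurableSet_upperC, add_comm,
      ← measure_inter_add_sdiff (B \ upperC) hlow, add_comm (zeroMeasure _ (B ∩ upperC)),
      ← add_assoc, add_comm (zeroMeasure _ (Complex.ofReal '' _))]
    congr 3
    · ext z
      simp only [Set.mem_inter_iff, Set.mem_sdiff, Set.mem_preimage, upperC, Set.mem_ofPred_eq,
        Complex.conj_im]
      exact ⟨fun h => ⟨h.1.1, h.2⟩, fun h => ⟨⟨h.1, by linarith [h.2]⟩, h.2⟩⟩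
    · ext z
      simp only [Set.mem_sdiff, Set.mem_image, Set.mem_preimage, upperC, Set.mem_ofPred_eq,
        Complex.conj_im]
      constructor
      · rintro ⟨⟨hz, h1⟩, h2⟩
        have : ((z.re : ℝ) : ℂ) = z := Complex.ext (by simp) (by simp; linarith)
        exact ⟨z.re, by rwa [this], this⟩
      · rintro ⟨x, hx, rfl⟩
        exact ⟨⟨hx, by simp⟩, by simp⟩
  simp only [h]
  exact (aemeasurable_zeroMeasure_ofReal_image hn (Complex.measurable_ofReal hB)).add
    ((aemeasurable_zeroMeasure_of_subset_upperC (hB.inter measurableSet_upperC)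
      Set.inter_subset_right).add
    (aemeasurable_zeroMeasure_of_subset_upperC (hconj.inter measurableSet_upperC)
      Set.inter_subset_right))

end ZeroMeasurability

/-! ### From products of disjoint sets to the whole configuration space. -/

section Covering

/-- Each coincidence `x i = x i'` with `i ≠ i'` cuts out a proper subspace, hence a null set. -/
theorem ae_injective (F : Type*) [NormedAddCommGroup F] [NormedSpace ℝ F] [FiniteDimensional ℝ F]
    [MeasureSpace F] [BorelSpace F] [Nontrivial F] [(volume : Measure F).IsAddHaarMeasure] (N : ℕ) :
    ∀ᵐ x : Fin N → F, Function.Injective x := by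
  have h : ∀ i i' : Fin N, i ≠ i' → ∀ᵐ x : Fin N → F, x i ≠ x i' := by
    intro i i' hne
    let L : (Fin N → F) →ₗ[ℝ] F := LinearMap.proj (R := ℝ) (φ := fun _ => F) i - LinearMap.proj i'
    have hL : LinearMap.ker L ≠ ⊤ := by
      intro htop
      obtain ⟨y, hy⟩ := exists_ne (0 : F)
      have : L (Pi.single i y) = 0 := LinearMap.mem_ker.1 (htop ▸ Submodule.mem_top)
      simp [L, hne.symm] at this
      exact hy this
    have h0 := Measure.addHaar_submodule (volume : Measure (Fin N → F)) _ hL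
    filter_upwards [measure_eq_zero_iff_ae_notMem.1 h0] with x hx he
    exact hx (by simp [L, he])
  have h' : ∀ᵐ x : Fin N → F, ∀ i i', i ≠ i' → x i ≠ x i' :=
    ae_all_iff.2 fun i => ae_all_iff.2 fun i' => by
    by_cases hne : i = i'
    · exact Filter.Eventually.of_forall fun x h => absurd hne h
    · exact (h i i' hne).mono fun x hx _ => hx
  filter_upwards [h'] with x hx i i' he
  by_contra hne
  exact hx i i' hne he

variable {k l : ℕ}

theorem measurableSet_mixedDomain : MeasurableSet (mixedDomain k l) := by
  have : mixedDomain k l = ⋂ j, {p | p.2 j ∈ upperC} := by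
    ext p; simp [mixedDomain]
  rw [this]
  exact MeasurableSet.iInter fun j =>
    (measurable_pi_apply j).comp measurable_snd measurableSet_upperC

theorem IsDisjointFamily.prod_subset_mixedDomain {A : Fin k → Set ℝ} {B : Fin l → Set ℂ}
    (h : IsDisjointFamily A B) : (Set.univ.pi A) ×ˢ (Set.univ.pi B) ⊆ mixedDomain k l :=
  fun _ hp j => h.subset j (hp.2 j trivial)

/-- A property that holds almost everywhere on every product of disjoint Borel sets holds almost
everywhere. -/
theorem ae_mixedDomain_of_forall_family {φ : (Fin k → ℝ) × (Fin l → ℂ) → Prop}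
    (h : ∀ (A : Fin k → Set ℝ) (B : Fin l → Set ℂ), IsDisjointFamily A B →
      ∀ᵐ p ∂(volume.restrict ((Set.univ.pi A) ×ˢ (Set.univ.pi B))), φ p) :
    ∀ᵐ p ∂(volume.restrict (mixedDomain k l)), φ p := by
  let Q := (Fin k → TopologicalSpace.countableBasis ℝ) ×
    (Fin l → TopologicalSpace.countableBasis ℂ)
  let A : Q → Fin k → Set ℝ := fun q i => q.1 i
  let B : Q → Fin l → Set ℂ := fun q j => (q.2 j : Set ℂ) ∩ upperC
  have : Countable (TopologicalSpace.countableBasis ℝ) :=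
    (TopologicalSpace.countable_countableBasis ℝ).to_subtype
  have : Countable (TopologicalSpace.countableBasis ℂ) :=
    (TopologicalSpace.countable_countableBasis ℂ).to_subtype
  -- There are only countably many families of basic open sets, so the exceptional sets can be
  -- united.
  have hq : ∀ q : Q, ∀ᵐ p, IsDisjointFamily (A q) (B q) →
      p ∈ (Set.univ.pi (A q)) ×ˢ (Set.univ.pi (B q)) → φ p := by
    intro q
    by_cases hd : IsDisjointFamily (A q) (B q)
    · exact ((ae_restrict_iff' hd.measurableSet_prod).1 (h _ _ hd)).mono fun p hp _ => hp
    · exact Filter.Eventually.of_forall fun p hp => absurd hp hd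
  have hx : ∀ᵐ p : (Fin k → ℝ) × (Fin l → ℂ), Function.Injective p.1 :=
    Measure.quasiMeasurePreserving_fst.ae (ae_injective ℝ k)
  have hz : ∀ᵐ p : (Fin k → ℝ) × (Fin l → ℂ), Function.Injective p.2 :=
    Measure.quasiMeasurePreserving_snd.ae (ae_injective ℂ l)
  rw [ae_restrict_iff' measurableSet_mixedDomain]
  filter_upwards [ae_all_iff.2 hq, hx, hz] with p hp hpx hpz hpd
  have hbx := TopologicalSpace.isBasis_countableBasis ℝ
  have hbz := TopologicalSpace.isBasis_countableBasis ℂ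
  -- Distinct coordinates have disjoint basic neighbourhoods, so `p` lies in one of the countably
  -- many products.
  obtain ⟨U, hU, hUd⟩ := Pairwise.exists_mem_filter_basis_of_disjoint
    (pairwise_disjoint_nhds.comp_of_injective hpx) fun i => hbx.nhds_hasBasis (a := p.1 i)
  obtain ⟨V, hV, hVd⟩ := Pairwise.exists_mem_filter_basis_of_disjoint
    (pairwise_disjoint_nhds.comp_of_injective hpz) fun j => hbz.nhds_hasBasis (a := p.2 j)
  refine hp (fun i => ⟨U i, (hU i).1⟩, fun j => ⟨V j, (hV j).1⟩) ⟨?_, ?_, ?_, ?_, ?_⟩ ⟨?_, ?_⟩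
  · exact fun i => (hbx.isOpen (hU i).1).measurableSet
  · exact fun j => (hbz.isOpen (hV j).1).measurableSet.inter measurableSet_upperC
  · exact fun j => Set.inter_subset_right
  · exact hUd
  · exact fun j j' hne => (hVd hne).mono Set.inter_subset_left Set.inter_subset_left
  · exact fun i _ => (hU i).2
  · exact fun j _ => ⟨(hV j).2, hpd j⟩

end Covering

/-! ### Finiteness, existence and uniqueness of the correlation function. -/

section Correlation
open scoped ENNReal

variable {Ω : Type*} [MeasurableSpace Ω] {P : Measure Ω} [IsProbabilityMeasure P] {n k l : ℕ}
  {f : Fin (n + 1) → ℝ → ℝ} {ξ : Fin (n + 1) → Ω → ℝ}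

/-- The law of the coefficients is absolutely continuous, so Lebesgue null sets of coefficient
vectors are negligible. -/
theorem AEMeasurable.comp_coeffs {F : (Fin (n + 1) → ℝ) → ℝ≥0∞} (hF : AEMeasurable F)
    (hf_meas : ∀ i, Measurable (f i)) (hξ_meas : ∀ i, Measurable (ξ i)) (hξ_indep : iIndepFun ξ P)
    (hξ_density : ∀ i, P.map (ξ i) = volume.withDensity (fun t => ENNReal.ofReal (f i t))) :
    AEMeasurable (fun ω => F fun i => ξ i ω) P := by
  refine AEMeasurable.comp_aemeasurable (g := F) ?_ (measurable_pi_lambda _ hξ_meas).aemeasurable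
  rw [map_coeffs_eq_withDensity hf_meas hξ_meas hξ_indep hξ_density]
  exact hF.mono_ac (withDensity_absolutelyContinuous _ _)

theorem ae_coeffs_random_ne_zero
    (hf_meas : ∀ i, Measurable (f i)) (hξ_meas : ∀ i, Measurable (ξ i)) (hξ_indep : iIndepFun ξ P)
    (hξ_density : ∀ i, P.map (ξ i) = volume.withDensity (fun t => ENNReal.ofReal (f i t))) :
    ∀ᵐ ω ∂P, (fun i => ξ i ω) ≠ 0 := by
  refine ae_of_ae_map (p := fun b : Fin (n + 1) → ℝ => b ≠ 0) (measurable_pi_lambda _ hξ_meas).aemeasurable ?_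
  rw [map_coeffs_eq_withDensity hf_meas hξ_meas hξ_indep hξ_density]
  exact (withDensity_absolutelyContinuous _ _).ae_le (ae_coeffs_ne_zero n)

theorem lintegral_zeroCount (hm : k + 2 * l ≤ n) {A : Fin k → Set ℝ} {B : Fin l → Set ℂ}
    (h : IsDisjointFamily A B) (hf_meas : ∀ i, Measurable (f i)) (hf_nonneg : ∀ i t, 0 ≤ f i t)
    (hξ_meas : ∀ i, Measurable (ξ i)) (hξ_indep : iIndepFun ξ P)
    (hξ_density : ∀ i, P.map (ξ i) = volume.withDensity (fun t => ENNReal.ofReal (f i t))) :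
    ∫⁻ ω, zeroCount A B (randomPoly ξ ω) ∂P =
      ∫⁻ p in (Set.univ.pi A) ×ˢ (Set.univ.pi B), mixedDensity n f p := by
  have hN := aemeasurable_zeroCount hm h
  have hlaw := map_coeffs_eq_withDensity hf_meas hξ_meas hξ_indep hξ_density
  have hN' : AEMeasurable (fun b : Fin (n + 1) → ℝ => zeroCount A B (realPoly b))
      (P.map fun ω i => ξ i ω) := by
    rw [hlaw]
    exact hN.mono_ac (withDensity_absolutelyContinuous _ _)
  rw [← lintegral_density_mul_zeroCount hm h hf_meas hf_nonneg]
  refine (lintegral_map' hN' (measurable_pi_lambda _ hξ_meas).aemeasurable).symm.trans ?_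
  rw [hlaw, lintegral_withDensity_eq_lintegral_mul₀ _ hN]
  · rfl
  · exact (Finset.measurable_fun_prod _ fun i _ =>
      ((hf_meas i).comp (measurable_pi_apply i)).ennreal_ofReal).aemeasurable

theorem zeroCount_le {A : Fin k → Set ℝ} {B : Fin l → Set ℂ} (h : IsDisjointFamily A B)
    {b : Fin (n + 1) → ℝ} (hb : b ≠ 0) : zeroCount A B (realPoly b) ≤ (n : ℝ≥0∞) ^ k * n ^ l := by
  have hle : ∀ S : Set ℂ, MeasurableSet S → zeroMeasure (realPoly b) S ≤ n := by
    intro S hS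
    rw [zeroMeasure_apply _ hS]
    have hsub : {z ∈ S | realPoly b z = 0} ⊆ {z | realPoly b z = 0} := fun z hz => hz.2
    exact_mod_cast ENat.toENNReal_le.2
      ((Set.encard_le_encard hsub).trans (encard_zeros_le hb))
  have hemb : MeasurableEmbedding Complex.ofReal :=
    Complex.isometry_ofReal.isClosedEmbedding.measurableEmbedding
  refine mul_le_mul' ?_ ?_
  · simpa using Finset.prod_le_pow_card Finset.univ
      (fun i => zeroMeasure (realPoly b) (Complex.ofReal '' A i)) _
      fun i _ => hle _ (hemb.measurableSet_image.2 (h.measurable_left i))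
  · simpa using Finset.prod_le_pow_card Finset.univ
      (fun j => zeroMeasure (realPoly b) (B j)) _ fun j _ => hle _ (h.measurable_right j)

/-- The integral is the expectation of a count that is almost surely at most `n ^ k * n ^ l`. -/
theorem lintegral_mixedDensity_ne_top (hm : k + 2 * l ≤ n) {A : Fin k → Set ℝ}
    {B : Fin l → Set ℂ} (h : IsDisjointFamily A B) (hf_meas : ∀ i, Measurable (f i))
    (hf_nonneg : ∀ i t, 0 ≤ f i t) (hξ_meas : ∀ i, Measurable (ξ i)) (hξ_indep : iIndepFun ξ P)
    (hξ_density : ∀ i, P.map (ξ i) = volume.withDensity (fun t => ENNReal.ofReal (f i t))) :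
    ∫⁻ p in (Set.univ.pi A) ×ˢ (Set.univ.pi B), mixedDensity n f p ≠ ⊤ := by
  rw [← lintegral_zeroCount hm h hf_meas hf_nonneg hξ_meas hξ_indep hξ_density]
  have hle : ∫⁻ ω, zeroCount A B (randomPoly ξ ω) ∂P ≤ ∫⁻ _, (n : ℝ≥0∞) ^ k * n ^ l ∂P := by
    refine lintegral_mono_ae ?_
    filter_upwards [ae_coeffs_random_ne_zero hf_meas hξ_meas hξ_indep hξ_density] with ω hω
    exact zeroCount_le h hω
  refine ne_top_of_le_ne_top ?_ hle
  rw [lintegral_const, measure_univ, mul_one]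
  exact ENNReal.mul_ne_top (ENNReal.pow_ne_top (ENNReal.natCast_ne_top n))
    (ENNReal.pow_ne_top (ENNReal.natCast_ne_top n))

theorem rho_nonneg (hf_nonneg : ∀ i t, 0 ≤ f i t) {m : ℕ} (w : Fin m → ℂ) : 0 ≤ rho n f w :=
  mul_nonneg (absVandermonde_nonneg w) (integral_nonneg fun t => rhoIntegrand_nonneg hf_nonneg w t)

/-- At distinct points the Vandermonde factor is positive, so a finite product forces a finite
integral over `t`; the Bochner integral in `rho` then agrees with the one in `[0, ∞]`. -/
theorem integrable_and_mixedDensity_eq (hf_meas : ∀ i, Measurable (f i))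
    (hf_nonneg : ∀ i t, 0 ≤ f i t) {p : (Fin k → ℝ) × (Fin l → ℂ)}
    (hinj : Function.Injective (withConj p.1 p.2)) (hfin : mixedDensity n f p < ⊤) :
    Integrable (rhoIntegrand n f (withConj p.1 p.2)) ∧
      ENNReal.ofReal (2 ^ l * rho n f (withConj p.1 p.2)) = mixedDensity n f p := by
  have hpos : 0 < 2 ^ l * absVandermonde (withConj p.1 p.2) :=
    mul_pos (by positivity)
      (lt_of_le_of_ne (absVandermonde_nonneg _) (absVandermonde_ne_zero hinj).symm)
  have hlt : ∫⁻ t, ENNReal.ofReal (rhoIntegrand n f (withConj p.1 p.2) t) < ⊤ := by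
    refine lt_top_iff_ne_top.2 fun htop => hfin.ne ?_
    rw [mixedDensity, htop, ENNReal.mul_top (ENNReal.ofReal_pos.2 hpos).ne']
  have hint : Integrable (rhoIntegrand n f (withConj p.1 p.2)) := by
    refine ⟨(measurable_rhoIntegrand_right hf_meas _).aestronglyMeasurable, ?_⟩
    rwa [hasFiniteIntegral_iff_ofReal
      (Filter.Eventually.of_forall fun t => rhoIntegrand_nonneg hf_nonneg _ t)]
  refine ⟨hint, ?_⟩
  rw [rho, mixedDensity, ← mul_assoc, ENNReal.ofReal_mul hpos.le,
    ofReal_integral_eq_lintegral_ofReal hint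
      (Filter.Eventually.of_forall fun t => rhoIntegrand_nonneg hf_nonneg _ t)]

theorem ae_integrable_and_mixedDensity_eq (hm : k + 2 * l ≤ n) (hf_meas : ∀ i, Measurable (f i))
    (hf_nonneg : ∀ i t, 0 ≤ f i t) (hξ_meas : ∀ i, Measurable (ξ i)) (hξ_indep : iIndepFun ξ P)
    (hξ_density : ∀ i, P.map (ξ i) = volume.withDensity (fun t => ENNReal.ofReal (f i t))) :
    ∀ᵐ p ∂(volume.restrict (mixedDomain k l)),
      Integrable (rhoIntegrand n f (withConj p.1 p.2)) ∧
        ENNReal.ofReal (2 ^ l * rho n f (withConj p.1 p.2)) = mixedDensity n f p := by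
  refine ae_mixedDomain_of_forall_family fun A B h => ?_
  filter_upwards [ae_restrict_mem h.measurableSet_prod,
    ae_lt_top (measurable_mixedDensity hf_meas) (lintegral_mixedDensity_ne_top hm h hf_meas
      hf_nonneg hξ_meas hξ_indep hξ_density)] with p hp hfin
  exact integrable_and_mixedDensity_eq hf_meas hf_nonneg (h.injective_withConj hp) hfin

theorem measurable_rho_withConj (hf_meas : ∀ i, Measurable (f i)) :
    Measurable fun p : (Fin k → ℝ) × (Fin l → ℂ) => rho n f (withConj p.1 p.2) := by
  refine (continuous_absVandermonde.comp continuous_withConj).measurable.mul ?_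
  exact (measurable_rhoIntegrand_withConj hf_meas).stronglyMeasurable.integral_prod_right'.measurable

theorem isMixedCorrelation_rho (hm : k + 2 * l ≤ n) (hf_meas : ∀ i, Measurable (f i))
    (hf_nonneg : ∀ i t, 0 ≤ f i t) (hξ_meas : ∀ i, Measurable (ξ i)) (hξ_indep : iIndepFun ξ P)
    (hξ_density : ∀ i, P.map (ξ i) = volume.withDensity (fun t => ENNReal.ofReal (f i t))) :
    IsMixedCorrelation P ξ k l (fun p => 2 ^ l * rho n f (withConj p.1 p.2)) where
  aemeasurable := ((measurable_rho_withConj hf_meas).const_mul _).aemeasurable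
  nonneg p _ := mul_nonneg (by positivity) (rho_nonneg hf_nonneg _)
  expectation_eq A B hA hB hBsub hAd hBd := by
    have h : IsDisjointFamily A B := ⟨hA, hB, hBsub, hAd, hBd⟩
    refine (lintegral_zeroCount hm h hf_meas hf_nonneg hξ_meas hξ_indep hξ_density).trans ?_
    refine lintegral_congr_ae ?_
    have hae := ae_restrict_of_ae_restrict_of_subset h.prod_subset_mixedDomain
      (ae_integrable_and_mixedDensity_eq hm hf_meas hf_nonneg hξ_meas hξ_indep hξ_density)
    exact hae.mono fun p hp => hp.2.symm

theorem IsDisjointFamily.inter {A : Fin k → Set ℝ} {B : Fin l → Set ℂ} (h : IsDisjointFamily A B)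
    {A' : Fin k → Set ℝ} {B' : Fin l → Set ℂ} (hA' : ∀ i, MeasurableSet (A' i))
    (hB' : ∀ j, MeasurableSet (B' j)) :
    IsDisjointFamily (fun i => A' i ∩ A i) (fun j => B' j ∩ B j) where
  measurable_left i := (hA' i).inter (h.measurable_left i)
  measurable_right j := (hB' j).inter (h.measurable_right j)
  subset j := Set.inter_subset_right.trans (h.subset j)
  disjoint_left _ _ hne := (h.disjoint_left hne).mono Set.inter_subset_right Set.inter_subset_right
  disjoint_right _ _ hne :=
    (h.disjoint_right hne).mono Set.inter_subset_right Set.inter_subset_right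

theorem isCountablySpanning_pi_measurableSet {ι : Type*} {α : ι → Type*}
    [∀ i, MeasurableSpace (α i)] :
    IsCountablySpanning (Set.univ.pi '' Set.univ.pi fun i => {s : Set (α i) | MeasurableSet s}) :=
  ⟨fun _ => Set.univ, fun _ => ⟨fun _ => Set.univ, fun _ _ => MeasurableSet.univ, by simp⟩,
    Set.iUnion_const _⟩

/-- Finite measures on a product of two products agree if they agree on all boxes. -/
theorem ext_of_forall_boxes {μ ν : Measure ((Fin k → ℝ) × (Fin l → ℂ))} [IsFiniteMeasure μ]
    (h : ∀ (A : Fin k → Set ℝ) (B : Fin l → Set ℂ), (∀ i, MeasurableSet (A i)) →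
      (∀ j, MeasurableSet (B j)) →
      μ ((Set.univ.pi A) ×ˢ (Set.univ.pi B)) = ν ((Set.univ.pi A) ×ˢ (Set.univ.pi B))) :
    μ = ν := by
  refine ext_of_generate_finite _ (generateFrom_eq_prod generateFrom_pi generateFrom_pi
    isCountablySpanning_pi_measurableSet isCountablySpanning_pi_measurableSet).symm
    (isPiSystem_pi.prod isPiSystem_pi) ?_ ?_
  · rintro _ ⟨_, ⟨A, hA, rfl⟩, _, ⟨B, hB, rfl⟩, rfl⟩
    exact h A B (fun i => hA i trivial) fun j => hB j trivial
  · simpa using h (fun _ => Set.univ) (fun _ => Set.univ) (fun _ => MeasurableSet.univ)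
      fun _ => MeasurableSet.univ

/-- Inside a fixed product `S` of disjoint sets, intersecting with any box gives again such a
product, so the defining identity tests all boxes. These form a π-system, and the finite measures
with the two densities coincide. -/
theorem IsMixedCorrelation.ae_eq {ρ : (Fin k → ℝ) × (Fin l → ℂ) → ℝ}
    (hρ : IsMixedCorrelation P ξ k l ρ) (hm : k + 2 * l ≤ n) (hf_meas : ∀ i, Measurable (f i))
    (hf_nonneg : ∀ i t, 0 ≤ f i t) (hξ_meas : ∀ i, Measurable (ξ i)) (hξ_indep : iIndepFun ξ P)
    (hξ_density : ∀ i, P.map (ξ i) = volume.withDensity (fun t => ENNReal.ofReal (f i t))) :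
    ∀ᵐ p ∂(volume.restrict (mixedDomain k l)), ρ p = 2 ^ l * rho n f (withConj p.1 p.2) := by
  have hae : ∀ᵐ p ∂(volume.restrict (mixedDomain k l)),
      ENNReal.ofReal (ρ p) = mixedDensity n f p := by
    refine ae_mixedDomain_of_forall_family fun A B h => ?_
    set S := (Set.univ.pi A) ×ˢ (Set.univ.pi B) with hS
    have hfin := lintegral_mixedDensity_ne_top hm h hf_meas hf_nonneg hξ_meas hξ_indep hξ_density
    have hval : ∀ (A' : Fin k → Set ℝ) (B' : Fin l → Set ℂ), (∀ i, MeasurableSet (A' i)) →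
        (∀ j, MeasurableSet (B' j)) →
        ∫⁻ p in ((Set.univ.pi A') ×ˢ (Set.univ.pi B')) ∩ S, mixedDensity n f p =
          ∫⁻ p in ((Set.univ.pi A') ×ˢ (Set.univ.pi B')) ∩ S, ENNReal.ofReal (ρ p) := by
      intro A' B' hA' hB'
      have h' := h.inter hA' hB'
      have hbox : ((Set.univ.pi A') ×ˢ (Set.univ.pi B')) ∩ S =
          (Set.univ.pi fun i => A' i ∩ A i) ×ˢ (Set.univ.pi fun j => B' j ∩ B j) := by
        rw [hS, Set.prod_inter_prod, Set.pi_inter_distrib, Set.pi_inter_distrib]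
      rw [hbox, ← lintegral_zeroCount hm h' hf_meas hf_nonneg hξ_meas hξ_indep hξ_density]
      exact hρ.expectation_eq _ _ h'.measurable_left h'.measurable_right h'.subset
        h'.disjoint_left h'.disjoint_right
    have hmeas : AEMeasurable (fun p => ENNReal.ofReal (ρ p)) (volume.restrict S) :=
      (hρ.aemeasurable.mono_measure
        (Measure.restrict_mono h.prod_subset_mixedDomain le_rfl)).ennreal_ofReal
    have : IsFiniteMeasure ((volume.restrict S).withDensity (mixedDensity n f)) :=
      isFiniteMeasure_withDensity hfin
    have heq : (volume.restrict S).withDensity (mixedDensity n f) =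
        (volume.restrict S).withDensity fun p => ENNReal.ofReal (ρ p) := by
      refine ext_of_forall_boxes fun A' B' hA' hB' => ?_
      have hbm : MeasurableSet ((Set.univ.pi A') ×ˢ (Set.univ.pi B')) :=
        (MeasurableSet.univ_pi hA').prod (MeasurableSet.univ_pi hB')
      rw [withDensity_apply _ hbm, withDensity_apply _ hbm, Measure.restrict_restrict hbm]
      exact hval A' B' hA' hB'
    exact ((withDensity_eq_iff (measurable_mixedDensity hf_meas).aemeasurable hmeas hfin).1 heq).symm
  filter_upwards [hae, ae_restrict_mem measurableSet_mixedDomain,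
    ae_integrable_and_mixedDensity_eq hm hf_meas hf_nonneg hξ_meas hξ_indep hξ_density]
    with p h1 hp h2
  rw [← h2.2] at h1
  -- Nonnegativity on `mixedDomain` is what lets `ENNReal.ofReal` be removed.
  exact (ENNReal.ofReal_eq_ofReal_iff (hρ.nonneg p hp)
    (mul_nonneg (by positivity) (rho_nonneg hf_nonneg _))).1 h1

/-- The sign changes by `(-1) ^ (2 * l) = 1`, and since `t` is real the cofactor has the same
absolute value at `z̄` as at `z`, whence the squares. -/
theorem rho_withConj_eq (x : Fin k → ℝ) (z : Fin l → ℂ) :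
    2 ^ l * rho n f (withConj x z) =
      2 ^ l * absVandermonde (withConj x z) *
        ∫ t : Fin (n - (k + 2 * l) + 1) → ℝ,
          (∏ i : Fin (n + 1), f i
            (∑ j : Fin (n - (k + 2 * l) + 1), (-1 : ℝ) ^ ((k : ℤ) - (i : ℕ) + (j : ℕ)) * t j *
              (elemSymm (((k + 2 * l : ℕ) : ℤ) - (i : ℕ) + (j : ℕ)) (withConj x z)).re)) *
          (∏ i : Fin k, |∑ j : Fin (n - (k + 2 * l) + 1), t j * x i ^ (j : ℕ)|) *
          ∏ i : Fin l, ‖∑ j : Fin (n - (k + 2 * l) + 1), (t j : ℂ) * z i ^ (j : ℕ)‖ ^ 2 := by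
  rw [rho, ← mul_assoc]
  congr 1
  refine integral_congr_ae (Filter.Eventually.of_forall fun t => ?_)
  have hsign : ∀ a : ℤ, (-1 : ℝ) ^ (((k + 2 * l : ℕ) : ℤ) + a) = (-1 : ℝ) ^ ((k : ℤ) + a) := by
    intro a
    rw [show ((k + 2 * l : ℕ) : ℤ) + a = (k : ℤ) + a + 2 * l by push_cast; ring,
      zpow_add₀ (by norm_num), zpow_mul]
    simp
  simp only [rhoIntegrand]
  rw [prod_withConj x z fun w => ‖∑ j : Fin (n - (k + 2 * l) + 1), (t j : ℂ) * w ^ (j : ℕ)‖,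
    mul_assoc]
  refine congrArg₂ (· * ·) ?_ (congrArg₂ (· * ·) ?_ ?_)
  · refine Finset.prod_congr rfl fun i _ => congrArg (f i) (Finset.sum_congr rfl fun j _ => ?_)
    rw [show ((k + 2 * l : ℕ) : ℤ) - (i : ℕ) + (j : ℕ) =
      ((k + 2 * l : ℕ) : ℤ) + (-(i : ℕ) + (j : ℕ)) by ring, hsign,
      show (k : ℤ) + (-(i : ℕ) + (j : ℕ)) = (k : ℤ) - (i : ℕ) + (j : ℕ) by ring]
    ring
  · refine Finset.prod_congr rfl fun i _ => ?_
    rw [← Real.norm_eq_abs, ← Complex.norm_real]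
    push_cast
    rfl
  · rw [← Finset.prod_mul_distrib]
    refine Finset.prod_congr rfl fun i _ => ?_
    rw [sq]
    congr 1
    rw [← Complex.norm_conj]
    simp

end Correlation

end

/-! ### The main theorem. -/

theorem mainTheorem4 {Ω : Type*} [MeasurableSpace Ω] (P : Measure Ω) [IsProbabilityMeasure P]
    (n k l : ℕ) (hpos : 0 < k + 2 * l) (hle : k + 2 * l ≤ n)
    (f : Fin (n + 1) → ℝ → ℝ) (hf_meas : ∀ i, Measurable (f i)) (hf_nonneg : ∀ i t, 0 ≤ f i t)
    (ξ : Fin (n + 1) → Ω → ℝ) (hξ_meas : ∀ i, Measurable (ξ i)) (hξ_indep : iIndepFun ξ P)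
    (hξ_density : ∀ i, P.map (ξ i) = volume.withDensity (fun t => ENNReal.ofReal (f i t))) :
    -- the number of zeros in a Borel set is a random variable
    (∀ B : Set ℂ, MeasurableSet B →
      AEMeasurable (fun ω => zeroMeasure (randomPoly ξ ω) B) P) ∧
    -- the symmetric functions of `(x, z, z̄)` are real
    (∀ (x : Fin k → ℝ) (z : Fin l → ℂ) (r : ℤ), (elemSymm r (withConj x z)).im = 0) ∧
    -- the integral defining `ρ_{k+2l}(x, z, z̄)` converges for almost every `(x, z)`
    (∀ᵐ p ∂(volume.restrict (mixedDomain k l)),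
      Integrable (rhoIntegrand n f (withConj p.1 p.2))) ∧
    -- `2^l ρ_{k+2l}(x, z, z̄)` is a mixed `(k,l)`-correlation function
    IsMixedCorrelation P ξ k l (fun p => 2 ^ l * rho n f (withConj p.1 p.2)) ∧
    -- every mixed `(k,l)`-correlation function is a version of it
    (∀ ρ : (Fin k → ℝ) × (Fin l → ℂ) → ℝ, IsMixedCorrelation P ξ k l ρ →
      ∀ᵐ p ∂(volume.restrict (mixedDomain k l)),
        ρ p = 2 ^ l * rho n f (withConj p.1 p.2)) ∧
    -- the explicit form
    (∀ (x : Fin k → ℝ) (z : Fin l → ℂ), (∀ j, z j ∈ upperC) →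
      2 ^ l * rho n f (withConj x z) =
        2 ^ l * absVandermonde (withConj x z) *
          ∫ t : Fin (n - (k + 2 * l) + 1) → ℝ,
            (∏ i : Fin (n + 1), f i
              (∑ j : Fin (n - (k + 2 * l) + 1), (-1 : ℝ) ^ ((k : ℤ) - (i : ℕ) + (j : ℕ)) * t j *
                (elemSymm (((k + 2 * l : ℕ) : ℤ) - (i : ℕ) + (j : ℕ)) (withConj x z)).re)) *
            (∏ i : Fin k, |∑ j : Fin (n - (k + 2 * l) + 1), t j * x i ^ (j : ℕ)|) *
            ∏ i : Fin l, ‖∑ j : Fin (n - (k + 2 * l) + 1), (t j : ℂ) * z i ^ (j : ℕ)‖ ^ 2) := by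
  refine ⟨fun B hB => ?_, fun x z r => elemSymm_im_eq_zero (map_mixedPoly x z) r, ?_,
    isMixedCorrelation_rho hle hf_meas hf_nonneg hξ_meas hξ_indep hξ_density,
    fun ρ hρ => hρ.ae_eq hle hf_meas hf_nonneg hξ_meas hξ_indep hξ_density,
    fun x z _ => rho_withConj_eq x z⟩
  · exact (aemeasurable_zeroMeasure (by omega) hB).comp_coeffs hf_meas hξ_meas hξ_indep hξ_density
  · exact (ae_integrable_and_mixedDensity_eq hle hf_meas hf_nonneg hξ_meas hξ_indep
      hξ_density).mono fun p hp => hp.1
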